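/- Theorem 4.1. Let $a>0$ and let $V:\mathbf R\to\mathbf C$ satisfy $e^{2a|x|}V\in L^2(\mathbf R)$. Let $X=L^2(\mathbf R,e^{2a|x|}dx)$ and $X'=L^2(\mathbf R,e^{-2a|x|}dx)$, let $K^\times$ be multiplication by $V$, and let $P(a)=\{\lambda : -a<\mathrm{Im}\sqrt\lambda<a\}$, as a part of the Riemann surface of $\sqrt\lambda$ with the branch point $\lambda=0$ removed; the global coordinate on it is $k=\sqrt\lambda$, holomorphy is with respect to $k$, and we write $\sqrt{-\lambda}=ik$. The first sheet is $-2\pi<\arg\lambda<0$, that is $\mathrm{Im}\,k<0$, so that $\mathrm{Re}\sqrt{-\lambda}>0$ there. For $\psi\in X$ put $\mathcal F[\psi](z)=(2\pi)^{-1/2}\int_{\mathbf R}\psi(x)e^{-ixz}dx$ for $|\mathrm{Im}\,z|<a$, and $$(\lambda-H)^{-1}\psi(x)=\frac1{\sqrt{2\pi}}\int_{\mathbf R}\frac{1}{\lambda-\xi^2}e^{ix\xi}\mathcal F[\psi](\xi)\,d\xi,\qquad \lambda\in\mathbf C\setminus[0,\infty),\quad H=-d^2/dx^2.$$ Let $A(\lambda)$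 be the continuation of $(\lambda-H)^{-1}$ from the first sheet to $P(a)$: $A(\lambda)\psi=(\lambda-H)^{-1}\psi$ if $\mathrm{Im}\,k<0$; if $k$ is real, $A(\lambda)\psi(x)$ is the limit of these values as $k$ is approached from $\mathrm{Im}\,k<0$; and $$A(\lambda)\psi(x)=(\lambda-H)^{-1}\psi(x)+\frac{\pi i}{\sqrt{2\pi}}\,\frac1k\left(e^{ikx}\mathcal F[\psi](k)+e^{-ikx}\mathcal F[\psi](-k)\right)\qquad\text{if } 0<\mathrm{Im}\,k<a.$$ A point $\lambda\in P(a)$ is a generalized eigenvalue of $-d^2/dx^2+V$ if $id-K^\times A(\lambda)$ is not injective on $X$. A generalized eigenfunction at $\lambda$ is a nonzero $\mu\in X'$ with $K^\times\mu\in X$ and $(id-A(\lambda)K^\times)\mu=0$. Fix $x_0\in\mathbf R$. For each $\lambda\in\mathbf C$ the equation $$\mu''+(\lambda-V)\mu=0\qquad(\mu\in C^1,\ \mu'\text{ locally absolutely continuous, equation a.e.})\tag{1}$$ has unique solutions $\nu_1(\cdot,\lambda)$, $\nu_2(\cdot,\lambda)$ with $(\nu_1,\nu_1')(x_0)=(1,0)$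 and $(\nu_2,\nu_2')(x_0)=(0,1)$. For $\lambda$ on the first sheet or in $P(a)$ and $\mu=\nu_1(\cdot,\lambda),\nu_2(\cdot,\lambda)$ the integrals in $$D(x,\lambda,\mu)=\mu(x)+\frac{1}{2\sqrt{-\lambda}}\int_x^\infty e^{-\sqrt{-\lambda}(y-x)}V(y)\mu(y)\,dy+\frac{1}{2\sqrt{-\lambda}}\int_{-\infty}^x e^{\sqrt{-\lambda}(y-x)}V(y)\mu(y)\,dy$$ converge, $D$ is differentiable in $x$, and $$\mathbb D(\lambda,\nu_1,\nu_2)=\det\begin{pmatrix}D(x,\lambda,\nu_1)&D(x,\lambda,\nu_2)\\ D'(x,\lambda,\nu_1)&D'(x,\lambda,\nu_2)\end{pmatrix}$$ does not depend on $x$. For $\lambda\in P(a)$ and $j=1,2$ one has $\nu_j\in X'$, $K^\times\nu_j\in X$ and $D(\cdot,\lambda,\nu_j)=(id-A(\lambda)K^\times)\nu_j$. For $\lambda$ on the first sheet there are solutions $\mu_\pm$ of (1) with $(\mu_+,\mu_+')e^{\sqrt{-\lambda}x}\to(1,-\sqrt{-\lambda})$ as $x\to\infty$ and $(\mu_-,\mu_-')e^{-\sqrt{-\lambda}x}\to(1,\sqrt{-\lambda})$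 as $x\to-\infty$, and the Evans function $\mathbb E(\lambda)=\mu_+(x)\mu_-'(x)-\mu_+'(x)\mu_-(x)$ depends neither on $x$ nor on the choice of such $\mu_\pm$. Moreover: (i) $\mathbb D(\lambda,\nu_1,\nu_2)$ is holomorphic on $P(a)$. (ii) For $\lambda\in P(a)$, $\mathbb D(\lambda,\nu_1,\nu_2)=0$ if and only if $\lambda$ is a generalized eigenvalue of $-d^2/dx^2+V$, and if and only if there is a generalized eigenfunction at $\lambda$. (iii) For every $\lambda$ on the first sheet, $\mathbb D(\lambda,\nu_1,\nu_2)=\dfrac{1}{2\sqrt{-\lambda}}\,\mathbb E(\lambda)$. -/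

import Mathlib

namespace ExpDecaySchrodinger

noncomputable section

/-- The weighted space `L²(ℝ, e^{2b|x|} dx)`, as a condition on a representative.
With `a > 0`, the rigged Hilbert space is `X = L²(e^{2a|x|} dx) ⊂ L² ⊂ X' = L²(e^{-2a|x|} dx)`:
membership in `X` is `MemWeightedL2 a`, membership in `X'` is `MemWeightedL2 (-a)`.
Elements of these spaces are functions up to almost everywhere equality. -/
def MemWeightedL2 (b : ℝ) (f : ℝ → ℂ) : Prop :=
  MeasureTheory.MemLp (fun x : ℝ => (Real.exp (b * |x|) : ℂ) * f x) 2 MeasureTheory.volume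

/-- The Riemann surface `P(a) = {λ | -a < Im √λ < a}`, without its branch point `λ = 0`, in the
global coordinate `k = √λ`; the point `k` lies over `λ = k²`.
The first sheet `-2π < arg λ < 0` is `Im k < 0`, the second sheet `0 < arg λ < 2π` is `Im k > 0`.
The branch of `√(-λ)` with positive real part on the first sheet is `√(-λ) = i k`. -/
def surface (a : ℝ) : Set ℂ := {k : ℂ | k ≠ 0 ∧ -a < k.im ∧ k.im < a}

/-- The Fourier transform `(2π)^{-1/2} ∫ ψ(x) e^{-i x z} dx` at a complex frequency `z`. -/
def fourierC (ψ : ℝ → ℂ) (z : ℂ) : ℂ :=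
  (1 / (Real.sqrt (2 * Real.pi) : ℂ)) * ∫ x : ℝ, ψ x * Complex.exp (-(Complex.I * x * z))

/-- The resolvent `(λ - H)⁻¹ ψ` of `H = -d²/dx²`, as a Fourier multiplier. -/
def freeResolvent (lam : ℂ) (ψ : ℝ → ℂ) (x : ℝ) : ℂ :=
  (1 / (Real.sqrt (2 * Real.pi) : ℂ)) *
    ∫ ξ : ℝ, (1 / (lam - (ξ : ℂ) ^ 2)) * Complex.exp (Complex.I * x * ξ) * fourierC ψ ξ

open Classical in
/-- The operator `A(λ)`, the analytic continuation of the free resolvent from the first sheet: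
the resolvent itself on the first sheet, its boundary value from the first sheet on the cut, and
the resolvent plus
`π i (2π)^{-1/2} (√λ)⁻¹ ∑_{ω = ±1} e^{i √λ x ω} 𝓕[ψ](√λ ω)` on the second sheet. -/
def contResolvent (k : ℂ) (ψ : ℝ → ℂ) (x : ℝ) : ℂ :=
  if k.im < 0 then
    freeResolvent (k ^ 2) ψ x
  else if k.im = 0 then
    Filter.limUnder (nhdsWithin k {k' : ℂ | k'.im < 0}) (fun k' : ℂ => freeResolvent (k' ^ 2) ψ x)
  else
    freeResolvent (k ^ 2) ψ x +
      (Real.pi * Complex.I / (Real.sqrt (2 * Real.pi) : ℂ)) * k⁻¹ *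
        (Complex.exp (Complex.I * k * x) * fourierC ψ k +
          Complex.exp (-(Complex.I * k * x)) * fourierC ψ (-k))

/-- Generalized eigenvalues (the generalized point spectrum) of `-d²/dx² + V`:
`id - K^× A(λ)` is not injective on `X`, where `K^×` is multiplication by `V`. -/
def IsGenEigenvalue (a : ℝ) (V : ℝ → ℂ) (k : ℂ) : Prop :=
  ∃ ψ : ℝ → ℂ, MemWeightedL2 a ψ ∧ ¬ (ψ =ᵐ[MeasureTheory.volume] 0) ∧
    ψ =ᵐ[MeasureTheory.volume] fun x => V x * contResolvent k ψ x

/-- Generalized eigenfunctions: the nonzero `μ ∈ X'` in the domain of `id - A(λ) K^×`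
(that is, with `K^× μ ∈ X`) such that `(id - A(λ) K^×) μ = 0`. -/
def IsGenEigenfunction (a : ℝ) (V : ℝ → ℂ) (k : ℂ) (μ : ℝ → ℂ) : Prop :=
  MemWeightedL2 (-a) μ ∧ ¬ (μ =ᵐ[MeasureTheory.volume] 0) ∧
    MemWeightedL2 a (fun x => V x * μ x) ∧
    μ =ᵐ[MeasureTheory.volume] contResolvent k (fun x => V x * μ x)

/-- Solutions of `u'' + (λ - V) u = 0`: `u` is differentiable, and `u'` is an indefinite integral
of `(V - λ) u` (so `u'` is locally absolutely continuous and the equation holds a.e.). -/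
def IsSolution (V : ℝ → ℂ) (lam : ℂ) (u : ℝ → ℂ) : Prop :=
  Differentiable ℝ u ∧
    (∀ x y : ℝ, IntervalIntegrable (fun t => (V t - lam) * u t) MeasureTheory.volume x y) ∧
    ∀ x y : ℝ, deriv u y - deriv u x = ∫ t in x..y, (V t - lam) * u t

/-- `D(x, λ, μ) = μ - A(λ) K^× μ`, in integral form with `√(-λ) = i k`. -/
def D (V : ℝ → ℂ) (k : ℂ) (μ : ℝ → ℂ) (x : ℝ) : ℂ :=
  μ x
    + (1 / (2 * (Complex.I * k))) *
        (∫ y in Set.Ioi x, Complex.exp (-(Complex.I * k) * (y - x)) * V y * μ y)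
    + (1 / (2 * (Complex.I * k))) *
        (∫ y in Set.Iic x, Complex.exp ((Complex.I * k) * (y - x)) * V y * μ y)

/-- The integrals in `D(x, λ, μ)` converge, and `D(x, λ, μ)` is differentiable in `x`. -/
def DWellDefined (V : ℝ → ℂ) (k : ℂ) (μ : ℝ → ℂ) : Prop :=
  (∀ x : ℝ, MeasureTheory.IntegrableOn
      (fun y : ℝ => Complex.exp (-(Complex.I * k) * (y - x)) * V y * μ y) (Set.Ioi x)) ∧
  (∀ x : ℝ, MeasureTheory.IntegrableOn
      (fun y : ℝ => Complex.exp ((Complex.I * k) * (y - x)) * V y * μ y) (Set.Iic x)) ∧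
  Differentiable ℝ (D V k μ)

/-- On `X'`, `D(·, λ, μ)` is `(id - A(λ) K^×) μ`, and `μ` lies in the domain of that operator. -/
def DIsOperator (a : ℝ) (V : ℝ → ℂ) (k : ℂ) (μ : ℝ → ℂ) : Prop :=
  MemWeightedL2 (-a) μ ∧ MemWeightedL2 a (fun x => V x * μ x) ∧
    ∀ x : ℝ, D V k μ x = μ x - contResolvent k (fun t => V t * μ t) x

/-- The Wronskian-type determinant of `D(x, λ, μ₁)` and `D(x, λ, μ₂)` at the point `x`. -/
def detD (V : ℝ → ℂ) (k : ℂ) (μ₁ μ₂ : ℝ → ℂ) (x : ℝ) : ℂ :=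
  Matrix.det !![D V k μ₁ x, D V k μ₂ x; deriv (D V k μ₁) x, deriv (D V k μ₂) x]

/-- The solution `μ₊`: `(μ₊, μ₊') e^{√(-λ) x} → (1, -√(-λ))` as `x → ∞`. -/
def IsMuPlus (V : ℝ → ℂ) (k : ℂ) (u : ℝ → ℂ) : Prop :=
  IsSolution V (k ^ 2) u ∧
    Filter.Tendsto (fun x : ℝ => u x * Complex.exp (Complex.I * k * x)) Filter.atTop (nhds 1) ∧
    Filter.Tendsto (fun x : ℝ => deriv u x * Complex.exp (Complex.I * k * x)) Filter.atTop
      (nhds (-(Complex.I * k)))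

/-- The solution `μ₋`: `(μ₋, μ₋') e^{-√(-λ) x} → (1, √(-λ))` as `x → -∞`. -/
def IsMuMinus (V : ℝ → ℂ) (k : ℂ) (u : ℝ → ℂ) : Prop :=
  IsSolution V (k ^ 2) u ∧
    Filter.Tendsto (fun x : ℝ => u x * Complex.exp (-(Complex.I * k * x))) Filter.atBot
      (nhds 1) ∧
    Filter.Tendsto (fun x : ℝ => deriv u x * Complex.exp (-(Complex.I * k * x))) Filter.atBot
      (nhds (Complex.I * k))

/-- `e` is the value at `k` of the Evans function: `μ₊` and `μ₋` exist, and for any such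
solutions `μ₊ μ₋' - μ₊' μ₋` is constantly equal to `e`. -/
def IsEvansValue (V : ℝ → ℂ) (k e : ℂ) : Prop :=
  (∃ u, IsMuPlus V k u) ∧ (∃ w, IsMuMinus V k w) ∧
    ∀ u w : ℝ → ℂ, IsMuPlus V k u → IsMuMinus V k w →
      ∀ x : ℝ, u x * deriv w x - deriv u x * w x = e

end

end ExpDecaySchrodinger

/-! Put c = ik = √(-λ), so that (1) reads u'' - c²u = Vu. Factoring the left side as (∂ - c)(∂ + c)u
or (∂ + c)(∂ - c)u and using the integrating factors e^{∓cx} shows that the limits p(u) = lim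
e^{-cx}(u' + cu) at +∞ and q(u) = lim e^{cx}(u' - cu) at -∞ exist: a solution grows at most like
e^{|Im k||x|}, and the weighted decay of V beats this for Im k < a. These are `coeffTop` and
`coeffBot`.

The identity u = ((u' + cu) - (u' - cu))/(2c) turns the definition of D into D(x) = (e^{cx} p(u) -
e^{-cx} q(u))/(2c) (`IsTame.D_eq`). So D solves the free equation, and the determinant is
(p(ν₁)q(ν₂) - q(ν₁)p(ν₂))/(2c), free of x (`IsTame.detD_eq`). All three claims are read off from
this formula.

(i) The ν_j are entire in λ by Picard iteration (`exists_isSolution`), and the growth bound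
`IsSolution.norm_le` is explicit enough in c to dominate the integrals in p and q locally uniformly
in k.

(ii) The determinant vanishes exactly when some nonzero solution u has p(u) = q(u) = 0, that is,
when D vanishes identically for u. On the whole of P(a), A(λ) is the integral operator with kernel
-(2c)⁻¹e^{-c|x-y|} (`contResolvent_eq_kernelOp`), so this says u = A(λ)Vu. The maps u ↦ Vu and ψ ↦
A(λ)ψ then match such u with the null vectors of id - K^×A(λ) and with the generalized
eigenfunctions.

(iii) On the first sheet, p(w) and q(w) are the Wronskians of w with μ₊ and μ₋. Evaluated at x₀ on
ν₁ and ν₂ they give the entries of the Wronskian of μ₊ and μ₋, which is the Evans function.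

As V is only locally integrable, u' is merely absolutely continuous. Calculus is therefore done with
indefinite integrals (`IsPrimitive`) rather than pointwise derivatives. -/

namespace ExpDecaySchrodinger

open MeasureTheory Set Filter Topology intervalIntegral

/-! ### Indefinite integrals -/

section Primitive

variable {𝕜 : Type*} [RCLike 𝕜]

/-- `F` is an indefinite integral of the locally integrable function `f`. -/
def IsPrimitive (F f : ℝ → 𝕜) : Prop :=
  ∀ x y : ℝ, IntervalIntegrable f volume x y ∧ ∫ t in x..y, f t = F y - F x

variable {F G f g : ℝ → 𝕜}

theorem IsPrimitive.intervalIntegrable (h : IsPrimitive F f) (x y : ℝ) :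
    IntervalIntegrable f volume x y := (h x y).1

theorem IsPrimitive.integral_eq (h : IsPrimitive F f) (x y : ℝ) :
    ∫ t in x..y, f t = F y - F x := (h x y).2

theorem IsPrimitive.eq_add (h : IsPrimitive F f) (x y : ℝ) :
    F y = F x + ∫ t in x..y, f t := by
  rw [h.integral_eq]; ring

theorem IsPrimitive.continuous (h : IsPrimitive F f) : Continuous F := by
  have h1 : F = fun y => F 0 + ∫ t in (0 : ℝ)..y, f t := funext fun y => h.eq_add 0 y
  rw [h1]
  exact continuous_const.add (continuous_primitive h.intervalIntegrable 0)

theorem IsPrimitive.congr_right (h : IsPrimitive F f) (hfg : f = g) : IsPrimitive F g := hfg ▸ h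

theorem IsPrimitive.congr_left (h : IsPrimitive F f) (hFG : F = G) : IsPrimitive G f := hFG ▸ h

theorem IsPrimitive.add (hF : IsPrimitive F f) (hG : IsPrimitive G g) :
    IsPrimitive (fun x => F x + G x) (fun x => f x + g x) := fun x y => by
  refine ⟨(hF x y).1.add (hG x y).1, ?_⟩
  rw [integral_add (hF x y).1 (hG x y).1, hF.integral_eq, hG.integral_eq]; ring

theorem IsPrimitive.const_mul (hF : IsPrimitive F f) (c : 𝕜) :
    IsPrimitive (fun x => c * F x) (fun x => c * f x) := fun x y => by
  refine ⟨(hF x y).1.const_mul c, ?_⟩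
  rw [intervalIntegral.integral_const_mul, hF.integral_eq]; ring

theorem IsPrimitive.sub (hF : IsPrimitive F f) (hG : IsPrimitive G g) :
    IsPrimitive (fun x => F x - G x) (fun x => f x - g x) := fun x y => by
  refine ⟨(hF x y).1.sub (hG x y).1, ?_⟩
  rw [integral_sub (hF x y).1 (hG x y).1, hF.integral_eq, hG.integral_eq]; ring

theorem isPrimitive_const (c : 𝕜) : IsPrimitive (fun _ => c) (fun _ => 0) := fun _ _ => by
  simp

theorem isPrimitive_of_hasDerivAt (h : ∀ x, HasDerivAt F (f x) x) (hf : Continuous f) :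
    IsPrimitive F f := fun _ _ =>
  ⟨hf.intervalIntegrable _ _,
    integral_eq_sub_of_hasDerivAt (fun t _ => h t) (hf.intervalIntegrable _ _)⟩

theorem isPrimitive_integral (hf : ∀ x y, IntervalIntegrable f volume x y) (x₀ : ℝ) :
    IsPrimitive (fun x => ∫ t in x₀..x, f t) f := fun x y =>
  ⟨hf x y, by rw [integral_interval_sub_left (hf _ _) (hf _ _)]⟩

theorem IsPrimitive.hasDerivAt (h : IsPrimitive F f) (hf : Continuous f) (x : ℝ) :
    HasDerivAt F (f x) x := by
  have h1 : F = fun y => F x + ∫ t in x..y, f t := funext fun y => h.eq_add x y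
  rw [h1]
  exact (integral_hasDerivAt_right (h.intervalIntegrable x x)
    hf.aestronglyMeasurable.stronglyMeasurableAtFilter hf.continuousAt).const_add _

theorem IsPrimitive.ae_hasDerivAt (h : IsPrimitive F f) (a b : ℝ) :
    ∀ᵐ x, x ∈ uIcc a b → HasDerivAt F (f x) x := by
  filter_upwards [(h.intervalIntegrable a b).ae_hasDerivAt_integral] with x hx hxm
  have h1 : F = fun y => F a + ∫ t in a..y, f t := funext fun y => h.eq_add a y
  rw [h1]
  exact (hx hxm a left_mem_uIcc).const_add _

theorem absolutelyContinuousOnInterval_const {X : Type*} [PseudoMetricSpace X] (c : X) (a b : ℝ) :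
    AbsolutelyContinuousOnInterval (fun _ : ℝ => c) a b :=
  LipschitzOnWith.absolutelyContinuousOnInterval (K := 0) (LipschitzWith.const c).lipschitzOnWith

/-- Reduction to the real-valued case: the integral is recombined from its real and imaginary parts.
-/
theorem absolutelyContinuousOnInterval_integral {a b : ℝ} (hf : IntervalIntegrable f volume a b) :
    AbsolutelyContinuousOnInterval (fun x => ∫ t in a..x, f t) a b := by
  have hre : IntervalIntegrable (fun t => RCLike.re (f t)) volume a b :=
    ⟨hf.1.re, hf.2.re⟩
  have him : IntervalIntegrable (fun t => RCLike.im (f t)) volume a b :=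
    ⟨hf.1.im, hf.2.im⟩
  have h1 := ((hre.absolutelyContinuousOnInterval_intervalIntegral left_mem_uIcc).fun_smul
      (absolutelyContinuousOnInterval_const (1 : 𝕜) a b)).add
    ((him.absolutelyContinuousOnInterval_intervalIntegral left_mem_uIcc).fun_smul
      (absolutelyContinuousOnInterval_const (RCLike.I : 𝕜) a b))
  have h2 : ∀ x ∈ uIcc a b, ∫ t in a..x, f t =
      (∫ t in a..x, RCLike.re (f t)) • (1 : 𝕜) + (∫ t in a..x, RCLike.im (f t)) • RCLike.I := by
    intro x hx
    have hfx : IntervalIntegrable f volume a x :=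
      hf.mono_set (uIcc_subset_uIcc left_mem_uIcc hx)
    have e1 : ∫ t in a..x, RCLike.re (f t) = RCLike.re (∫ t in a..x, f t) :=
      (RCLike.reCLM : 𝕜 →L[ℝ] ℝ).intervalIntegral_comp_comm hfx
    have e2 : ∫ t in a..x, RCLike.im (f t) = RCLike.im (∫ t in a..x, f t) :=
      (RCLike.imCLM : 𝕜 →L[ℝ] ℝ).intervalIntegral_comp_comm hfx
    rw [e1, e2, RCLike.real_smul_eq_coe_mul, RCLike.real_smul_eq_coe_mul, mul_one,
      RCLike.re_add_im]
  rw [absolutelyContinuousOnInterval_iff] at h1 ⊢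
  intro ε hε
  obtain ⟨δ, hδ, H⟩ := h1 ε hε
  refine ⟨δ, hδ, fun E hE hlt => lt_of_eq_of_lt ?_ (H E hE hlt)⟩
  refine Finset.sum_congr rfl fun i hi => ?_
  have hm := hE.1 i hi
  simp only [Pi.add_apply]
  rw [h2 _ hm.1, h2 _ hm.2]

theorem IsPrimitive.absolutelyContinuousOnInterval (h : IsPrimitive F f) (a b : ℝ) :
    AbsolutelyContinuousOnInterval F a b := by
  have h1 : F = (fun _ => F a) + fun y => ∫ t in a..y, f t := funext fun y => h.eq_add a y
  rw [h1]
  exact (absolutelyContinuousOnInterval_const _ a b).add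
    (absolutelyContinuousOnInterval_integral (h.intervalIntegrable a b))

/-- FG minus the integral of fG + Fg is absolutely continuous with derivative zero almost
everywhere, hence constant. This is the product rule behind every integrating factor and Wronskian
below. -/
theorem IsPrimitive.mul (hF : IsPrimitive F f) (hG : IsPrimitive G g) :
    IsPrimitive (fun x => F x * G x) (fun x => f x * G x + F x * g x) := by
  have hint : ∀ x y, IntervalIntegrable (fun t => f t * G t + F t * g t) volume x y := fun x y =>
    ((hF.intervalIntegrable x y).mul_continuousOn hG.continuous.continuousOn).add
      ((hG.intervalIntegrable x y).continuousOn_mul hF.continuous.continuousOn)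
  intro x y
  refine ⟨hint x y, ?_⟩
  have hprim := isPrimitive_integral hint x
  have hac := ((hF.absolutelyContinuousOnInterval x y).smul
    (hG.absolutelyContinuousOnInterval x y)).sub (hprim.absolutelyContinuousOnInterval x y)
  have hder : ∀ᵐ t, t ∈ uIcc x y →
      HasDerivAt (F • G - fun s => ∫ t in x..s, (f t * G t + F t * g t)) 0 t := by
    filter_upwards [hF.ae_hasDerivAt x y, hG.ae_hasDerivAt x y, hprim.ae_hasDerivAt x y]
      with t h1 h2 h3 ht
    have := ((h1 ht).mul (h2 ht)).sub (h3 ht)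
    rw [sub_self] at this
    exact this
  obtain ⟨C, hC⟩ := hac.const_of_ae_hasDerivAt_zero hder
  have ex := hC x left_mem_uIcc
  have ey := hC y right_mem_uIcc
  simp only [Pi.sub_apply, smul_eq_mul, Pi.mul_apply, integral_same, sub_zero] at ex ey
  rw [← ex] at ey
  simp only [← ey]; ring

theorem IsPrimitive.pow_succ_div_factorial {F f : ℝ → ℝ} (hF : IsPrimitive F f) (n : ℕ) :
    IsPrimitive (fun x => F x ^ (n + 1) / (n + 1).factorial)
      (fun x => f x * (F x ^ n / n.factorial)) := by
  induction n with
  | zero => simpa using hF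
  | succ n ih =>
    have h1 := (ih.mul hF).const_mul (1 / ((n : ℝ) + 2))
    refine (h1.congr_right (funext fun x => ?_)).congr_left (funext fun x => ?_)
    · rw [Nat.factorial_succ (n)]
      push_cast
      have := Nat.factorial_pos n
      field_simp
      ring
    · rw [Nat.factorial_succ (n + 1)]
      push_cast
      have := Nat.factorial_pos (n + 1)
      field_simp
      ring

end Primitive

/-! ### A Gronwall inequality with a locally integrable coefficient -/

/-- One step of an iterated integral raises the power and the factorial by one. To the left of x₀
the inner integral is nonpositive, and the resulting sign (-1)^n is absorbed by the outer absolute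
value. -/
theorem abs_integral_mul_abs_pow_div_factorial {v : ℝ → ℝ} (hv0 : ∀ x, 0 ≤ v x)
    (hv : ∀ x y, IntervalIntegrable v volume x y) (x₀ x : ℝ) (n : ℕ) :
    |∫ t in x₀..x, v t * (|∫ s in x₀..t, v s| ^ n / n.factorial)| =
      |∫ t in x₀..x, v t| ^ (n + 1) / (n + 1).factorial := by
  have hp := (isPrimitive_integral hv x₀).pow_succ_div_factorial n
  have key := hp.integral_eq x₀ x
  simp only [integral_same, ne_eq, Nat.add_eq_zero_iff, one_ne_zero, and_false, not_false_eq_true,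
    zero_pow, zero_div, sub_zero] at key
  have hfac : (0 : ℝ) < (n + 1).factorial := by exact_mod_cast Nat.factorial_pos _
  rcases le_total x₀ x with h | h
  · have : ∫ t in x₀..x, v t * (|∫ s in x₀..t, v s| ^ n / n.factorial) =
        ∫ t in x₀..x, v t * ((∫ s in x₀..t, v s) ^ n / n.factorial) := by
      refine integral_congr fun t ht => ?_
      rw [uIcc_of_le h] at ht
      rw [abs_of_nonneg (integral_nonneg ht.1 fun s _ => hv0 s)]
    rw [this, key, abs_div, abs_pow, abs_of_pos hfac]
  · have : ∫ t in x₀..x, v t * (|∫ s in x₀..t, v s| ^ n / n.factorial) =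
        ∫ t in x₀..x, (-1) ^ n * (v t * ((∫ s in x₀..t, v s) ^ n / n.factorial)) := by
      refine integral_congr fun t ht => ?_
      rw [uIcc_of_ge h] at ht
      have : ∫ s in x₀..t, v s ≤ 0 := by
        rw [integral_symm, neg_nonpos]
        exact integral_nonneg ht.2 fun s _ => hv0 s
      rw [abs_of_nonpos this, neg_pow]
      ring
    rw [this, intervalIntegral.integral_const_mul, key, abs_mul, abs_div, abs_pow, abs_pow,
      abs_of_pos hfac]
    simp

theorem abs_integral_mono {f g : ℝ → ℝ} {x₀ x : ℝ} (hf : IntervalIntegrable f volume x₀ x)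
    (hg : IntervalIntegrable g volume x₀ x) (h0 : ∀ t ∈ uIcc x₀ x, 0 ≤ f t)
    (h : ∀ t ∈ uIcc x₀ x, f t ≤ g t) : |∫ t in x₀..x, f t| ≤ |∫ t in x₀..x, g t| := by
  wlog hx : x₀ ≤ x generalizing x₀ x
  · rw [integral_symm, abs_neg, integral_symm x, abs_neg]
    exact this hf.symm hg.symm (uIcc_comm x₀ x ▸ h0) (uIcc_comm x₀ x ▸ h) (le_of_not_ge hx)
  rw [uIcc_of_le hx] at h0 h
  rw [abs_of_nonneg (integral_nonneg hx h0),
    abs_of_nonneg (integral_nonneg hx fun t ht => (h0 t ht).trans (h t ht))]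
  exact integral_mono_on hx hf hg h

/-- The inequality is inserted into itself n times: this produces a partial sum of the exponential
series plus a remainder M Fⁿ/n!, which tends to zero. The absolute values allow x on either side of
x₀. -/
theorem le_mul_exp_of_le_add_abs_integral {m v : ℝ → ℝ} {c x₀ x : ℝ} (hm : Continuous m)
    (hm0 : ∀ t, 0 ≤ m t) (hv0 : ∀ t, 0 ≤ v t) (hv : ∀ x y, IntervalIntegrable v volume x y)
    (h : ∀ t ∈ uIcc x₀ x, m t ≤ c + |∫ s in x₀..t, v s * m s|) :
    m x ≤ c * Real.exp |∫ s in x₀..x, v s| := by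
  set F : ℝ → ℝ := fun t => |∫ s in x₀..t, v s| with hF
  have hFc : Continuous F := (isPrimitive_integral hv x₀).continuous.abs
  obtain ⟨M, hM⟩ := (isCompact_uIcc (a := x₀) (b := x)).exists_bound_of_continuousOn
    hm.continuousOn
  have key : ∀ n : ℕ, ∀ t ∈ uIcc x₀ x,
      m t ≤ c * ∑ j ∈ Finset.range n, F t ^ j / j.factorial + M * (F t ^ n / n.factorial) := by
    intro n
    induction n with
    | zero =>
      intro t ht
      simpa using (le_abs_self _).trans (hM t ht)
    | succ n ih =>
      intro t ht
      refine (h t ht).trans ?_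
      have hsub : uIcc x₀ t ⊆ uIcc x₀ x := uIcc_subset_uIcc left_mem_uIcc ht
      have hterm : ∀ j : ℕ, IntervalIntegrable (fun s => v s * (F s ^ j / j.factorial))
          volume x₀ t := fun j =>
        (hv x₀ t).mul_continuousOn (by fun_prop)
      have hc0 : 0 ≤ c := by
        have := h x₀ left_mem_uIcc
        simp only [integral_same, abs_zero, add_zero] at this
        exact (hm0 x₀).trans this
      have hM0 : 0 ≤ M := (norm_nonneg _).trans (hM x₀ left_mem_uIcc)
      have hsum : IntervalIntegrable (fun s => c * ∑ j ∈ Finset.range n,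
          v s * (F s ^ j / j.factorial)) volume x₀ t :=
        (IntervalIntegrable.sum (Finset.range n) fun j _ => hterm j).const_mul c |>.congr
          fun s _ => by simp
      have hle : |∫ s in x₀..t, v s * m s| ≤ |∫ s in x₀..t,
          (c * ∑ j ∈ Finset.range n, v s * (F s ^ j / j.factorial) +
            M * (v s * (F s ^ n / n.factorial)))| := by
        refine abs_integral_mono ((hv x₀ t).mul_continuousOn hm.continuousOn)
          (hsum.add ((hterm n).const_mul M)) (fun s _ => mul_nonneg (hv0 s) (hm0 s))
          fun s hs => ?_
        refine (mul_le_mul_of_nonneg_left (ih s (hsub hs)) (hv0 s)).trans_eq ?_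
        rw [← Finset.mul_sum]
        ring
      have hle2 : |∫ s in x₀..t, (c * ∑ j ∈ Finset.range n, v s * (F s ^ j / j.factorial) +
            M * (v s * (F s ^ n / n.factorial)))| ≤
          c * ∑ j ∈ Finset.range n, F t ^ (j + 1) / (j + 1).factorial +
            M * (F t ^ (n + 1) / (n + 1).factorial) := by
        rw [integral_add hsum ((hterm n).const_mul M), intervalIntegral.integral_const_mul,
          intervalIntegral.integral_const_mul, integral_finsetSum fun j _ => hterm j]
        refine (abs_add_le _ _).trans ?_
        rw [abs_mul, abs_mul, abs_of_nonneg hc0, abs_of_nonneg hM0,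
          abs_integral_mul_abs_pow_div_factorial hv0 hv]
        gcongr
        refine (Finset.abs_sum_le_sum_abs _ _).trans_eq (Finset.sum_congr rfl fun j _ => ?_)
        rw [abs_integral_mul_abs_pow_div_factorial hv0 hv]
      rw [Finset.sum_range_succ']
      simp only [pow_zero, Nat.factorial_zero, Nat.cast_one, div_one]
      linarith
  have hlim : Tendsto (fun n : ℕ => c * ∑ j ∈ Finset.range n, F x ^ j / j.factorial +
      M * (F x ^ n / n.factorial)) atTop (𝓝 (c * Real.exp (F x) + M * 0)) := by
    refine Tendsto.add (Tendsto.const_mul _ ?_)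
      (Tendsto.const_mul _ (FloorSemiring.tendsto_pow_div_factorial_atTop (F x)))
    have := NormedSpace.expSeries_div_hasSum_exp (𝔸 := ℝ) (F x)
    rw [← Real.exp_eq_exp_ℝ] at this
    exact this.tendsto_sum_nat
  rw [mul_zero, add_zero] at hlim
  exact ge_of_tendsto' hlim fun n => key n x right_mem_uIcc

end ExpDecaySchrodinger

namespace ExpDecaySchrodinger

open MeasureTheory Set Filter Topology intervalIntegral

/-! ### Holomorphic dependence of integrals on a parameter -/

/-- A local bound on f alone suffices, because the Cauchy estimate turns it into a bound on the
derivative over a smaller disc. -/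
theorem differentiableOn_integral_of_dominated {μ : Measure ℝ} {U : Set ℂ} (hU : IsOpen U)
    {f : ℂ → ℝ → ℂ} (hmeas : ∀ z ∈ U, AEStronglyMeasurable (f z) μ)
    (hd : ∀ t, DifferentiableOn ℂ (fun z => f z t) U)
    (hb : ∀ z₀ ∈ U, ∃ r > 0, ∃ g : ℝ → ℝ, Integrable g μ ∧
      ∀ᵐ t ∂μ, ∀ z ∈ Metric.ball z₀ r ∩ U, ‖f z t‖ ≤ g t) :
    DifferentiableOn ℂ (fun z => ∫ t, f z t ∂μ) U := by
  intro z₀ hz₀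
  obtain ⟨r, hr, g, hg, hfg⟩ := hb z₀ hz₀
  obtain ⟨s, hs, hsU⟩ := Metric.isOpen_iff.1 (Metric.isOpen_ball.inter hU) z₀
    ⟨Metric.mem_ball_self hr, hz₀⟩
  -- A closed disc of radius ε around a point within ε of z₀ stays within 2s/3 of z₀.
  set ε : ℝ := s / 3 with hε
  have hε0 : 0 < ε := by positivity
  have hmem : ∀ z ∈ Metric.ball z₀ ε, Metric.closedBall z ε ⊆ Metric.ball z₀ r ∩ U := by
    intro z hz w hw
    refine hsU ?_
    rw [Metric.mem_ball] at hz ⊢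
    rw [Metric.mem_closedBall] at hw
    calc dist w z₀ ≤ dist w z + dist z z₀ := dist_triangle _ _ _
      _ < s := by rw [hε] at *; linarith
  have hder : ∀ t, ∀ z ∈ Metric.ball z₀ ε, HasDerivAt (fun z => f z t)
      (deriv (fun z => f z t) z) z := fun t z hz =>
    ((hd t).differentiableAt (hU.mem_nhds (hmem z hz (Metric.mem_closedBall_self hε0.le)).2)
      ).hasDerivAt
  have hz0 : z₀ ∈ Metric.ball z₀ ε := Metric.mem_ball_self hε0
  have hseq : Tendsto (fun n : ℕ => ((ε / ((n : ℝ) + 1) : ℝ) : ℂ)) atTop (𝓝[≠] 0) := by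
    refine tendsto_nhdsWithin_iff.2 ⟨?_, Eventually.of_forall fun n => ?_⟩
    · have h1 : Tendsto (fun n : ℕ => ε / ((n : ℝ) + 1)) atTop (𝓝 0) := by
        simpa [div_eq_mul_inv] using
          (tendsto_one_div_add_atTop_nhds_zero_nat (𝕜 := ℝ)).const_mul ε
      rw [← Complex.ofReal_zero]
      exact (Complex.continuous_ofReal.tendsto 0).comp h1
    · have : (0 : ℝ) < ε / ((n : ℝ) + 1) := by positivity
      exact Complex.ofReal_ne_zero.2 this.ne'
  -- The derivative is measurable in t as the limit of the difference quotients along the increments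
  -- ε/(n+1).
  have hmeas' : AEStronglyMeasurable (fun t => deriv (fun z => f z t) z₀) μ := by
    refine aestronglyMeasurable_of_tendsto_ae atTop
      (f := fun (n : ℕ) t => ((ε / ((n : ℝ) + 1) : ℝ) : ℂ)⁻¹ •
        (f (z₀ + ((ε / ((n : ℝ) + 1) : ℝ) : ℂ)) t - f z₀ t)) (fun n => ?_)
      (Eventually.of_forall fun t =>
        (hasDerivAt_iff_tendsto_slope_zero.1 (hder t z₀ hz0)).comp hseq)
    refine AEStronglyMeasurable.fun_const_smul
      (AEStronglyMeasurable.fun_sub (hmeas _ ?_) (hmeas _ hz₀)) _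
    refine (hmem z₀ hz0 ?_).2
    rw [Metric.mem_closedBall, dist_eq_norm, add_sub_cancel_left, Complex.norm_real,
      Real.norm_of_nonneg (by positivity)]
    exact div_le_self hε0.le (by linarith [(Nat.cast_nonneg n : (0 : ℝ) ≤ n)])
  refine ((hasDerivAt_integral_of_dominated_loc_of_deriv_le (F := f)
    (F' := fun z t => deriv (fun z => f z t) z) (bound := fun t => g t / ε)
    (Metric.ball_mem_nhds z₀ hε0) ?_ ?_ hmeas' ?_ (hg.div_const _)
    (Eventually.of_forall hder)).2).differentiableAt.differentiableWithinAt
  · filter_upwards [hU.mem_nhds hz₀] with z hz using hmeas z hz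
  · refine hg.mono' (hmeas z₀ hz₀) ?_
    filter_upwards [hfg] with t ht using ht z₀ ⟨Metric.mem_ball_self hr, hz₀⟩
  · filter_upwards [hfg] with t ht z hz
    refine Complex.norm_deriv_le_of_forall_mem_sphere_norm_le hε0 ?_ fun w hw =>
      ht w (hmem z hz (Metric.sphere_subset_closedBall hw))
    refine DifferentiableOn.diffContOnCl ?_
    rw [closure_ball _ hε0.ne']
    exact (hd t).mono fun w hw => (hmem z hz hw).2

/-! ### Solutions of the initial value problem -/

theorem isPrimitive_ofReal : IsPrimitive (fun x : ℝ => (x : ℂ)) (fun _ => 1) :=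
  isPrimitive_of_hasDerivAt (fun _ => Complex.ofRealCLM.hasDerivAt) continuous_const

/-- The kernel x - t performs two successive integrations at once. Splitting it as x∫q - ∫tq reduces
the claim to the product rule. -/
theorem isPrimitive_integral_sub_mul {q : ℝ → ℂ}
    (hq : ∀ x y, IntervalIntegrable q volume x y) (x₀ : ℝ) :
    IsPrimitive (fun x : ℝ => ∫ t in x₀..x, ((x : ℂ) - t) * q t)
      (fun x => ∫ t in x₀..x, q t) := by
  have htq : ∀ x y, IntervalIntegrable (fun t : ℝ => (t : ℂ) * q t) volume x y := fun x y =>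
    (hq x y).continuousOn_mul Complex.continuous_ofReal.continuousOn
  have h := (isPrimitive_ofReal.mul (isPrimitive_integral hq x₀)).sub
    (isPrimitive_integral htq x₀)
  refine (h.congr_right (funext fun x => by ring)).congr_left (funext fun x => ?_)
  rw [← intervalIntegral.integral_const_mul, ← integral_sub ((hq _ _).const_mul _) (htq _ _)]
  exact integral_congr fun t _ => by ring

section Solution

variable {V : ℝ → ℂ} {lam : ℂ} {u w : ℝ → ℂ}

theorem IsSolution.isPrimitive_deriv (h : IsSolution V lam u) :
    IsPrimitive (deriv u) (fun t => (V t - lam) * u t) := fun x y =>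
  ⟨h.2.1 x y, (h.2.2 x y).symm⟩

theorem IsSolution.continuous_deriv (h : IsSolution V lam u) : Continuous (deriv u) :=
  h.isPrimitive_deriv.continuous

theorem IsSolution.continuous (h : IsSolution V lam u) : Continuous u := h.1.continuous

theorem IsSolution.isPrimitive (h : IsSolution V lam u) : IsPrimitive u (deriv u) :=
  isPrimitive_of_hasDerivAt (fun x => (h.1 x).hasDerivAt) h.continuous_deriv

theorem isSolution_of_isPrimitive {u' : ℝ → ℂ} (h : IsPrimitive u u')
    (h' : IsPrimitive u' (fun t => (V t - lam) * u t)) :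
    IsSolution V lam u ∧ deriv u = u' := by
  have hd := h.hasDerivAt h'.continuous
  have hu' : deriv u = u' := funext fun x => (hd x).deriv
  refine ⟨⟨fun x => (hd x).differentiableAt, h'.intervalIntegrable, fun x y => ?_⟩, hu'⟩
  rw [hu', h'.integral_eq]

theorem IsSolution.linear_combination (hu : IsSolution V lam u) (hw : IsSolution V lam w)
    (a b : ℂ) : IsSolution V lam (fun x => a * u x + b * w x) ∧
      deriv (fun x => a * u x + b * w x) = fun x => a * deriv u x + b * deriv w x := by
  refine isSolution_of_isPrimitive ((hu.isPrimitive.const_mul a).add (hw.isPrimitive.const_mul b))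
    (((hu.isPrimitive_deriv.const_mul a).add (hw.isPrimitive_deriv.const_mul b)).congr_right ?_)
  ext x; ring

theorem IsSolution.eq_integral (h : IsSolution V lam u) (x₀ x : ℝ) :
    u x = u x₀ + deriv u x₀ * (x - x₀) + ∫ t in x₀..x, ((x : ℂ) - t) * ((V t - lam) * u t) := by
  have h1 := (isPrimitive_integral_sub_mul h.2.1 x₀).integral_eq x₀ x
  have h2 : ∫ s in x₀..x, ∫ t in x₀..s, (V t - lam) * u t =
      ∫ s in x₀..x, (deriv u s - deriv u x₀) :=
    integral_congr fun s _ => (h.2.2 x₀ s).symm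
  rw [h2, integral_sub (h.continuous_deriv.intervalIntegrable _ _) (by simp),
    h.isPrimitive.integral_eq, intervalIntegral.integral_const, integral_same, sub_zero,
    Complex.real_smul] at h1
  rw [← h1]
  push_cast
  ring

/-- Two solutions with the same data at `x₀`, for potentials which agree between `x₀` and `x`,
agree at `x`. -/
theorem IsSolution.eq_of_eqOn {V₁ V₂ : ℝ → ℂ} (hu : IsSolution V₁ lam u)
    (hw : IsSolution V₂ lam w) (hV : ∀ x y, IntervalIntegrable V₁ volume x y) {x₀ x : ℝ}
    (hVV : ∀ t ∈ uIoc x₀ x, V₁ t = V₂ t) (h0 : u x₀ = w x₀) (h1 : deriv u x₀ = deriv w x₀) :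
    u x = w x := by
  -- R bounds the Volterra kernel |t - s| on the segment. Gronwall with constant c = 0 then forces
  -- the difference to vanish.
  set R : ℝ := |x - x₀| with hR
  have hvint : ∀ a b, IntervalIntegrable (fun t => R * (‖V₁ t‖ + ‖lam‖)) volume a b := fun a b =>
    ((hV a b).norm.add intervalIntegrable_const).const_mul R
  have key := le_mul_exp_of_le_add_abs_integral (m := fun t => ‖u t - w t‖)
    (v := fun t => R * (‖V₁ t‖ + ‖lam‖)) (c := 0) (x₀ := x₀) (x := x)
    (hu.continuous.sub hw.continuous).norm (fun t => norm_nonneg _) (fun t => by positivity) hvint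
    (fun t ht => ?_)
  · rw [zero_mul] at key
    exact sub_eq_zero.1 (norm_le_zero_iff.1 key)
  · have hsub : uIoc x₀ t ⊆ uIoc x₀ x := uIoc_subset_uIoc_of_uIcc_subset_uIcc
      (uIcc_subset_uIcc left_mem_uIcc ht)
    have e : u t - w t = ∫ s in x₀..t, ((t : ℂ) - s) * ((V₁ s - lam) * (u s - w s)) := by
      rw [hu.eq_integral x₀ t, hw.eq_integral x₀ t, h0, h1, add_sub_add_left_eq_sub,
        ← integral_sub ((hu.2.1 _ _).continuousOn_mul (by fun_prop))
          ((hw.2.1 _ _).continuousOn_mul (by fun_prop))]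
      refine integral_congr_ae (Eventually.of_forall fun s hs => ?_)
      rw [← hVV s (hsub hs)]
      ring
    rw [zero_add]
    rw [e]
    refine norm_integral_le_abs_integral_norm.trans (abs_integral_mono ?_
      ((hvint _ _).mul_continuousOn (hu.continuous.sub hw.continuous).norm.continuousOn)
      (fun s _ => norm_nonneg _) fun s hs => ?_)
    · refine IntervalIntegrable.norm (IntervalIntegrable.continuousOn_mul
        (IntervalIntegrable.mul_continuousOn ((hV _ _).sub intervalIntegrable_const)
          (hu.continuous.sub hw.continuous).continuousOn) (by fun_prop))
    · rw [norm_mul, norm_mul, mul_assoc]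
      gcongr
      · rw [← Complex.ofReal_sub, Complex.norm_real, Real.norm_eq_abs]
        exact (abs_sub_right_of_mem_uIcc hs).trans (abs_sub_left_of_mem_uIcc ht)
      · exact norm_sub_le _ _

theorem IsSolution.ext (hu : IsSolution V lam u) (hw : IsSolution V lam w)
    (hV : ∀ x y, IntervalIntegrable V volume x y) {x₀ : ℝ}
    (h0 : u x₀ = w x₀) (h1 : deriv u x₀ = deriv w x₀) : u = w :=
  funext fun _ => hu.eq_of_eqOn hw hV (fun _ _ => rfl) h0 h1

end Solution

/-! ### Picard series and entire dependence on λ -/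

section Picard

/-- The terms of the Picard series of the initial value problem
`u'' = (V - λ) u`, `u x₀ = c₀`, `u' x₀ = c₁`. -/
noncomputable def picardTerm (V : ℝ → ℂ) (x₀ : ℝ) (c₀ c₁ : ℂ) : ℕ → ℂ → ℝ → ℂ
  | 0, _, x => c₀ + c₁ * (x - x₀)
  | n + 1, lam, x => ∫ t in x₀..x, ((x : ℂ) - t) * ((V t - lam) * picardTerm V x₀ c₀ c₁ n lam t)

variable {V : ℝ → ℂ}

theorem continuous_picardTerm (hV : ∀ x y, IntervalIntegrable V volume x y) (x₀ : ℝ) (c₀ c₁ : ℂ)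
    (n : ℕ) (lam : ℂ) : Continuous (picardTerm V x₀ c₀ c₁ n lam) := by
  induction n with
  | zero => simp only [picardTerm]; fun_prop
  | succ n ih =>
    exact (isPrimitive_integral_sub_mul (q := fun t => (V t - lam) * picardTerm V x₀ c₀ c₁ n lam t)
      (fun a b => ((hV a b).sub intervalIntegrable_const).mul_continuousOn ih.continuousOn)
      x₀).continuous

/-- Each iteration costs a factor R from the kernel and one more integral of ‖V‖ + Λ; the nesting of
the integrals supplies the factorial. -/
theorem norm_picardTerm_le (hV : ∀ x y, IntervalIntegrable V volume x y) {x₀ : ℝ} (c₀ c₁ : ℂ)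
    {R Λ : ℝ} (hR : 0 ≤ R) (hΛ : 0 ≤ Λ) {lam : ℂ} (hlam : ‖lam‖ ≤ Λ) (n : ℕ) {x : ℝ}
    (hx : |x - x₀| ≤ R) :
    ‖picardTerm V x₀ c₀ c₁ n lam x‖ ≤ (‖c₀‖ + ‖c₁‖ * R) * R ^ n *
      (|∫ t in x₀..x, (‖V t‖ + Λ)| ^ n / n.factorial) := by
  have hv : ∀ x y, IntervalIntegrable (fun t => ‖V t‖ + Λ) volume x y := fun x y =>
    (hV x y).norm.add intervalIntegrable_const
  have hc : Continuous fun x => ∫ t in x₀..x, (‖V t‖ + Λ) :=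
    (isPrimitive_integral hv x₀).continuous
  induction n generalizing x with
  | zero =>
    simp only [picardTerm, pow_zero, mul_one, Nat.factorial_zero, Nat.cast_one, div_one]
    refine (norm_add_le _ _).trans ?_
    rw [norm_mul, ← Complex.ofReal_sub, Complex.norm_real, Real.norm_eq_abs]
    gcongr
  | succ n ih =>
    simp only [picardTerm]
    have hmaj : IntervalIntegrable (fun t => (‖c₀‖ + ‖c₁‖ * R) * R ^ (n + 1) *
        ((‖V t‖ + Λ) * (|∫ s in x₀..t, (‖V s‖ + Λ)| ^ n / n.factorial))) volume x₀ x :=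
      ((hv _ _).mul_continuousOn (by fun_prop)).const_mul _
    refine (norm_integral_le_abs_integral_norm.trans
      (abs_integral_mono ?_ hmaj (fun t _ => norm_nonneg _) fun t ht => ?_)).trans_eq ?_
    · exact ((((hV _ _).sub intervalIntegrable_const).mul_continuousOn
        (continuous_picardTerm hV x₀ c₀ c₁ n lam).continuousOn).continuousOn_mul
          (by fun_prop)).norm
    · have h1 : |t - x₀| ≤ R := (abs_sub_left_of_mem_uIcc ht).trans hx
      have h2 : ‖(x : ℂ) - t‖ ≤ R := by
        rw [← Complex.ofReal_sub, Complex.norm_real, Real.norm_eq_abs]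
        exact (abs_sub_right_of_mem_uIcc ht).trans hx
      have h3 : ‖V t - lam‖ ≤ ‖V t‖ + Λ := (norm_sub_le _ _).trans (by gcongr)
      rw [norm_mul, norm_mul]
      calc _ ≤ R * ((‖V t‖ + Λ) * ((‖c₀‖ + ‖c₁‖ * R) * R ^ n *
            (|∫ s in x₀..t, (‖V s‖ + Λ)| ^ n / n.factorial))) := by
              gcongr
              exact ih h1
        _ = _ := by ring
    · rw [intervalIntegral.integral_const_mul, abs_mul, abs_of_nonneg (by positivity),
        abs_integral_mul_abs_pow_div_factorial (fun t => by positivity) hv]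

theorem differentiable_picardTerm (hV : ∀ x y, IntervalIntegrable V volume x y) (x₀ : ℝ)
    (c₀ c₁ : ℂ) (n : ℕ) (x : ℝ) :
    Differentiable ℂ (fun lam => picardTerm V x₀ c₀ c₁ n lam x) := by
  induction n generalizing x with
  | zero => simp only [picardTerm]; fun_prop
  | succ n ih =>
    have hcont := fun lam => continuous_picardTerm hV x₀ c₀ c₁ n lam
    simp only [picardTerm, intervalIntegral_eq_integral_uIoc]
    refine Differentiable.const_smul (differentiableOn_univ.1
      (differentiableOn_integral_of_dominated isOpen_univ (fun z _ => ?_) (fun t => ?_)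
        fun z₀ _ => ?_)) _
    · exact (intervalIntegrable_iff.1 ((((hV _ _).sub intervalIntegrable_const).mul_continuousOn
        (hcont z).continuousOn).continuousOn_mul (by fun_prop))).aestronglyMeasurable
    · exact (Differentiable.const_mul (Differentiable.mul (by fun_prop) (ih t)) _).differentiableOn
    · set R := |x - x₀| with hR
      set Λ := ‖z₀‖ + 1 with hΛ
      have hv : ∀ x y, IntervalIntegrable (fun t => ‖V t‖ + Λ) volume x y := fun x y =>
        (hV x y).norm.add intervalIntegrable_const
      have hc : Continuous fun x => ∫ t in x₀..x, (‖V t‖ + Λ) :=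
        (isPrimitive_integral hv x₀).continuous
      refine ⟨1, one_pos, fun t => R * ((‖V t‖ + Λ) * ((‖c₀‖ + ‖c₁‖ * R) * R ^ n *
            (|∫ s in x₀..t, (‖V s‖ + Λ)| ^ n / n.factorial))), ?_, ?_⟩
      · exact intervalIntegrable_iff.1 (((hv _ _).mul_continuousOn (by fun_prop)).const_mul _)
      · filter_upwards [ae_restrict_mem measurableSet_uIoc] with t ht z hz
        have ht' := uIoc_subset_uIcc ht
        have hzΛ : ‖z‖ ≤ Λ := by
          have := mem_ball_iff_norm.1 hz.1
          linarith [norm_le_insert' z z₀]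
        have h1 : |t - x₀| ≤ R := abs_sub_left_of_mem_uIcc ht'
        have h2 : ‖(x : ℂ) - t‖ ≤ R := by
          rw [← Complex.ofReal_sub, Complex.norm_real, Real.norm_eq_abs]
          exact abs_sub_right_of_mem_uIcc ht'
        have h3 : ‖V t - z‖ ≤ ‖V t‖ + Λ := (norm_sub_le _ _).trans (by gcongr)
        rw [norm_mul, norm_mul]
        gcongr
        exact norm_picardTerm_le hV c₀ c₁ (abs_nonneg _) (by positivity) hzΛ n h1

/-- The initial value problem for `u'' = (V - λ) u` has solutions which are entire in `λ`. -/
theorem exists_isSolution (hV : ∀ x y, IntervalIntegrable V volume x y) (x₀ : ℝ) (c₀ c₁ : ℂ) :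
    ∃ y : ℂ → ℝ → ℂ, (∀ lam, IsSolution V lam (y lam) ∧ y lam x₀ = c₀ ∧ deriv (y lam) x₀ = c₁) ∧
      ∀ x, Differentiable ℂ (fun lam => y lam x) := by
  -- A summable majorant uniform for |x - x₀| ≤ R and ‖λ‖ ≤ Λ. It serves the continuity in x, the
  -- termwise integration and the holomorphy in λ.
  have hbound : ∀ R Λ : ℝ, 0 ≤ R → 0 ≤ Λ → ∃ s : ℕ → ℝ, Summable s ∧ ∀ n lam x, ‖lam‖ ≤ Λ →
      |x - x₀| ≤ R → ‖picardTerm V x₀ c₀ c₁ n lam x‖ ≤ s n := by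
    intro R Λ hR hΛ
    have hv : ∀ x y, IntervalIntegrable (fun t => ‖V t‖ + Λ) volume x y := fun x y =>
      (hV x y).norm.add intervalIntegrable_const
    set W := |∫ t in (x₀ - R)..(x₀ + R), (‖V t‖ + Λ)|
    refine ⟨fun n => (‖c₀‖ + ‖c₁‖ * R) * ((R * W) ^ n / n.factorial),
      (Real.summable_pow_div_factorial _).mul_left _, fun n lam x hlam hx => ?_⟩
    refine (norm_picardTerm_le hV c₀ c₁ hR hΛ hlam n hx).trans ?_
    simp only [mul_assoc, mul_pow, mul_div_assoc]
    gcongr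
    rw [abs_le] at hx
    refine abs_integral_mono_interval ?_ (Eventually.of_forall fun t => ?_) (hv _ _)
    · rw [uIoc_of_le (show x₀ - R ≤ x₀ + R by linarith), uIoc]
      exact Ioc_subset_Ioc (le_min (by linarith) (by linarith)) (max_le (by linarith) (by linarith))
    · simp only [Pi.zero_apply]; positivity
  set y : ℂ → ℝ → ℂ := fun lam x => ∑' n, picardTerm V x₀ c₀ c₁ n lam x with hy
  have hycont : ∀ lam, Continuous (y lam) := by
    intro lam
    refine continuous_iff_continuousAt.2 fun x => ?_
    obtain ⟨s, hs, hle⟩ := hbound (|x - x₀| + 1) ‖lam‖ (by positivity) (norm_nonneg _)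
    have := continuousOn_tsum (s := Metric.ball x 1)
      (fun n => (continuous_picardTerm hV x₀ c₀ c₁ n lam).continuousOn) hs
      (fun n z hz => hle n lam z le_rfl (by
        rw [Metric.mem_ball, Real.dist_eq] at hz
        linarith [abs_sub_le z x x₀]))
    exact this.continuousAt (Metric.ball_mem_nhds x one_pos)
  have heq : ∀ lam x, y lam x = c₀ + c₁ * (x - x₀) +
      ∫ t in x₀..x, ((x : ℂ) - t) * ((V t - lam) * y lam t) := by
    intro lam x
    obtain ⟨s, hs, hle⟩ := hbound |x - x₀| ‖lam‖ (abs_nonneg _) (norm_nonneg _)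
    have hsum : ∀ t ∈ uIcc x₀ x, HasSum (fun n => picardTerm V x₀ c₀ c₁ n lam t) (y lam t) :=
      fun t ht => (Summable.of_norm_bounded hs fun n =>
        hle n lam t le_rfl (abs_sub_left_of_mem_uIcc ht)).hasSum
    have h1 := hasSum_integral_of_dominated_convergence (μ := volume) (a := x₀) (b := x)
      (F := fun n t => ((x : ℂ) - t) * ((V t - lam) * picardTerm V x₀ c₀ c₁ n lam t))
      (f := fun t => ((x : ℂ) - t) * ((V t - lam) * y lam t))
      (fun n t => ‖(x : ℂ) - t‖ * ‖V t - lam‖ * s n) (fun n => ?_)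
      (fun n => Eventually.of_forall fun t ht => ?_)
      (Eventually.of_forall fun t _ => hs.mul_left _) ?_
      (Eventually.of_forall fun t ht =>
        ((hsum t (uIoc_subset_uIcc ht)).mul_left _).mul_left _)
    · have h2 := (hsum x right_mem_uIcc).summable.tsum_eq_zero_add
      rw [hy]
      simp only
      rw [h2]
      exact congrArg _ h1.tsum_eq
    · exact (intervalIntegrable_iff.1 ((((hV _ _).sub intervalIntegrable_const).mul_continuousOn
        (continuous_picardTerm hV x₀ c₀ c₁ n lam).continuousOn).continuousOn_mul
          (by fun_prop))).aestronglyMeasurable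
    · rw [norm_mul, norm_mul, ← mul_assoc]
      gcongr
      exact hle n lam t le_rfl (abs_sub_left_of_mem_uIcc (uIoc_subset_uIcc ht))
    · simp only [tsum_mul_left]
      exact ((((hV _ _).sub intervalIntegrable_const).norm).continuousOn_mul
        (by fun_prop)).mul_const _
  refine ⟨y, fun lam => ?_, fun x => ?_⟩
  · have hq : ∀ a b, IntervalIntegrable (fun t => (V t - lam) * y lam t) volume a b := fun a b =>
      ((hV a b).sub intervalIntegrable_const).mul_continuousOn (hycont lam).continuousOn
    have hp : IsPrimitive (y lam) (fun x => c₁ + ∫ t in x₀..x, (V t - lam) * y lam t) := by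
      have := (((isPrimitive_const (c₀ - c₁ * x₀)).add (isPrimitive_ofReal.const_mul c₁)).add
        (isPrimitive_integral_sub_mul hq x₀))
      refine (this.congr_right (funext fun x => by ring)).congr_left (funext fun x => ?_)
      rw [heq lam x]
      ring
    obtain ⟨hsol, hder⟩ := isSolution_of_isPrimitive hp
      (((isPrimitive_const c₁).add (isPrimitive_integral hq x₀)).congr_right
        (funext fun x => by ring))
    refine ⟨hsol, ?_, ?_⟩
    · rw [heq]; simp
    · rw [hder]; simp
  · intro lam
    obtain ⟨s, hs, hle⟩ := hbound |x - x₀| (‖lam‖ + 1) (abs_nonneg _) (by positivity)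
    have := Complex.differentiableOn_tsum_of_summable_norm (U := Metric.ball lam 1) hs
      (fun n => (differentiable_picardTerm hV x₀ c₀ c₁ n x).differentiableOn) Metric.isOpen_ball
      (fun n z hz => hle n z x (by
        have := mem_ball_iff_norm.1 hz
        linarith [norm_le_insert' z lam]) le_rfl)
    exact this.differentiableAt (Metric.ball_mem_nhds lam one_pos)

end Picard

end ExpDecaySchrodinger

namespace ExpDecaySchrodinger

open MeasureTheory Set Filter Topology intervalIntegral

/-! ### Growth of solutions -/

theorem hasDerivAt_cexp_mul_ofReal (c : ℂ) (x : ℝ) :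
    HasDerivAt (fun x : ℝ => Complex.exp (c * x)) (c * Complex.exp (c * x)) x := by
  have h : HasDerivAt (fun x : ℝ => c * (x : ℂ)) c x := by
    simpa using (Complex.ofRealCLM.hasDerivAt (x := x)).const_mul c
  simpa [mul_comm] using h.cexp

theorem isPrimitive_cexp (c : ℂ) : IsPrimitive (fun x : ℝ => Complex.exp (c * x))
    (fun x : ℝ => c * Complex.exp (c * x)) :=
  isPrimitive_of_hasDerivAt (hasDerivAt_cexp_mul_ofReal c) (by fun_prop)

section Growth

variable {V : ℝ → ℂ} {lam c : ℂ} {u w : ℝ → ℂ}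

/-- The factorization (∂ - c)(∂ + c)u = Vu with integrating factor e^{-cx}. Since only c² is
prescribed, it applies to -c as well. -/
theorem IsSolution.isPrimitive_exp_mul (h : IsSolution V lam u) (hc : c ^ 2 = -lam) :
    IsPrimitive (fun x : ℝ => Complex.exp (-c * x) * (deriv u x + c * u x))
      (fun x : ℝ => Complex.exp (-c * x) * (V x * u x)) := by
  refine ((isPrimitive_cexp (-c)).mul
    (h.isPrimitive_deriv.add (h.isPrimitive.const_mul c))).congr_right (funext fun x => ?_)
  have : lam = -c ^ 2 := by rw [hc]; ring
  rw [this]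
  ring

theorem IsSolution.deriv_add_mul_eq (h : IsSolution V lam u) (hc : c ^ 2 = -lam) (x₀ x : ℝ) :
    deriv u x + c * u x = Complex.exp (c * (x - x₀)) * (deriv u x₀ + c * u x₀) +
      ∫ t in x₀..x, Complex.exp (c * (x - t)) * (V t * u t) := by
  have h1 := (h.isPrimitive_exp_mul hc).eq_add x₀ x
  have h2 : deriv u x + c * u x =
      Complex.exp (c * x) * (Complex.exp (-c * x) * (deriv u x + c * u x)) := by
    rw [← mul_assoc, ← Complex.exp_add]; simp
  rw [h2, h1, mul_add, ← mul_assoc, ← Complex.exp_add, ← intervalIntegral.integral_const_mul]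
  congr 1
  · congr 2; ring
  · refine integral_congr fun t _ => ?_
    rw [← mul_assoc, ← Complex.exp_add]
    congr 2; ring

/-- For t between x₀ and x, |x - t| = |x - x₀| - |t - x₀|. The growth thus splits into a factor in x
and a weight in t, as Gronwall requires. -/
theorem norm_cexp_mul_sub_le {x₀ x t : ℝ} (ht : t ∈ uIcc x₀ x) (c : ℂ) :
    ‖Complex.exp (c * (x - t))‖ ≤
      Real.exp (|c.re| * |x - x₀|) * Real.exp (-(|c.re| * |t - x₀|)) := by
  rw [Complex.norm_exp, ← Real.exp_add, ← Complex.ofReal_sub, Complex.re_mul_ofReal]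
  refine Real.exp_le_exp.2 ?_
  have h1 : |x - t| = |x - x₀| - |t - x₀| := by
    rcases le_total x₀ x with h | h
    · rw [uIcc_of_le h] at ht
      rw [abs_of_nonneg (sub_nonneg.2 ht.1), abs_of_nonneg (sub_nonneg.2 ht.2),
        abs_of_nonneg (sub_nonneg.2 h)]; ring
    · rw [uIcc_of_ge h] at ht
      rw [abs_of_nonpos (sub_nonpos.2 ht.1), abs_of_nonpos (sub_nonpos.2 ht.2),
        abs_of_nonpos (sub_nonpos.2 h)]; ring
  calc c.re * (x - t) ≤ |c.re| * |x - t| := by rw [← abs_mul]; exact le_abs_self _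
    _ = _ := by rw [h1]; ring

theorem IsSolution.norm_deriv_add_mul_le (h : IsSolution V lam u)
    (hV : ∀ x y, IntervalIntegrable V volume x y) (hc : c ^ 2 = -lam) (x₀ x : ℝ) :
    ‖deriv u x + c * u x‖ ≤ Real.exp (|c.re| * |x - x₀|) * (‖deriv u x₀‖ + ‖c‖ * ‖u x₀‖ +
      |∫ t in x₀..x, ‖V t‖ * (Real.exp (-(|c.re| * |t - x₀|)) * ‖u t‖)|) := by
  rw [h.deriv_add_mul_eq hc x₀ x, mul_add (Real.exp _)]
  refine (norm_add_le _ _).trans (add_le_add ?_ ?_)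
  · rw [norm_mul]
    refine mul_le_mul ?_ ((norm_add_le _ _).trans_eq (by rw [norm_mul])) (norm_nonneg _)
      (Real.exp_pos _).le
    simpa using norm_cexp_mul_sub_le (left_mem_uIcc (a := x₀) (b := x)) c
  · rw [← abs_of_pos (Real.exp_pos (|c.re| * |x - x₀|)), ← abs_mul,
      ← intervalIntegral.integral_const_mul]
    have hu := h.continuous
    refine norm_integral_le_abs_integral_norm.trans (abs_integral_mono ?_ ?_
      (fun t _ => norm_nonneg _) fun t ht => ?_)
    · exact (((hV _ _).mul_continuousOn hu.continuousOn).continuousOn_mul (by fun_prop)).norm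
    · exact ((hV _ _).norm.mul_continuousOn (by fun_prop)).const_mul _
    · rw [norm_mul, norm_mul]
      calc _ ≤ Real.exp (|c.re| * |x - x₀|) * Real.exp (-(|c.re| * |t - x₀|)) *
            (‖V t‖ * ‖u t‖) := by
              gcongr
              exact norm_cexp_mul_sub_le ht c
        _ = _ := by ring

theorem abs_intervalIntegral_le_integral {v : ℝ → ℝ} (hv : Integrable v) (hv0 : ∀ x, 0 ≤ v x)
    (x y : ℝ) : |∫ t in x..y, v t| ≤ ∫ t, v t := by
  rw [abs_intervalIntegral_eq, abs_of_nonneg (integral_nonneg hv0)]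
  exact setIntegral_le_integral hv (Eventually.of_forall hv0)

/-- Subtracting the bounds for u' + cu and u' - cu isolates 2cu; Gronwall is applied to e^{-|Re c||t
- x₀|}‖u‖ with coefficient ‖V‖/‖c‖. The constant is kept explicit because holomorphy needs it
locally uniform in c. -/
theorem IsSolution.norm_le (h : IsSolution V lam u) (hV : Integrable V) (hc : c ^ 2 = -lam)
    (hc0 : c ≠ 0) (x₀ x : ℝ) :
    ‖u x‖ ≤ (‖u x₀‖ + ‖deriv u x₀‖ / ‖c‖) * Real.exp ((∫ t, ‖V t‖) / ‖c‖) *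
      Real.exp (|c.re| * |x - x₀|) := by
  have hVi : ∀ x y, IntervalIntegrable V volume x y := fun x y => hV.intervalIntegrable
  have hcn : 0 < ‖c‖ := norm_pos_iff.2 hc0
  have hu := h.continuous
  have key := le_mul_exp_of_le_add_abs_integral
    (m := fun t => Real.exp (-(|c.re| * |t - x₀|)) * ‖u t‖) (v := fun t => ‖V t‖ / ‖c‖)
    (c := ‖u x₀‖ + ‖deriv u x₀‖ / ‖c‖) (x₀ := x₀) (x := x) (by fun_prop)
    (fun t => by positivity) (fun t => by positivity) (fun x y => (hVi x y).norm.div_const _)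
    fun t _ => ?_
  · have h1 : |∫ t in x₀..x, ‖V t‖ / ‖c‖| ≤ (∫ t, ‖V t‖) / ‖c‖ := by
      rw [← MeasureTheory.integral_div]
      exact abs_intervalIntegral_le_integral (hV.norm.div_const _) (fun t => by positivity) _ _
    have h2 : ‖u x‖ = Real.exp (-(|c.re| * |x - x₀|)) * ‖u x‖ * Real.exp (|c.re| * |x - x₀|) := by
      rw [mul_right_comm, ← Real.exp_add]; simp
    rw [h2]
    refine mul_le_mul_of_nonneg_right (key.trans ?_) (Real.exp_pos _).le
    gcongr
  · have e : 2 * c * u t = (deriv u t + c * u t) - (deriv u t + -c * u t) := by ring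
    have b1 := h.norm_deriv_add_mul_le hVi hc x₀ t
    have b2 := h.norm_deriv_add_mul_le hVi (c := -c) (by rw [neg_sq, hc]) x₀ t
    rw [norm_neg, Complex.neg_re, abs_neg] at b2
    have b3 := norm_sub_le (deriv u t + c * u t) (deriv u t + -c * u t)
    rw [← e, norm_mul, norm_mul, Complex.norm_two] at b3
    have e2 : ∫ s in x₀..t, ‖V s‖ / ‖c‖ * (Real.exp (-(|c.re| * |s - x₀|)) * ‖u s‖) =
        (∫ s in x₀..t, ‖V s‖ * (Real.exp (-(|c.re| * |s - x₀|)) * ‖u s‖)) / ‖c‖ := by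
      rw [← intervalIntegral.integral_div]
      exact integral_congr fun s _ => by ring
    rw [e2, abs_div, abs_of_pos hcn]
    set J := |∫ s in x₀..t, ‖V s‖ * (Real.exp (-(|c.re| * |s - x₀|)) * ‖u s‖)|
    set X := Real.exp (|c.re| * |t - x₀|) with hX
    have hX0 : 0 < X := Real.exp_pos _
    have h4 : ‖c‖ * ‖u t‖ ≤ X * (‖deriv u x₀‖ + ‖c‖ * ‖u x₀‖ + J) := by linarith
    rw [Real.exp_neg, ← hX, inv_mul_le_iff₀ hX0]
    calc ‖u t‖ = ‖c‖ * ‖u t‖ / ‖c‖ := by field_simp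
      _ ≤ X * (‖deriv u x₀‖ + ‖c‖ * ‖u x₀‖ + J) / ‖c‖ := by gcongr
      _ = _ := by field_simp; ring

theorem IsSolution.exists_norm_le (h : IsSolution V lam u) (hV : Integrable V)
    (hc : c ^ 2 = -lam) (hc0 : c ≠ 0) :
    ∃ C, ∀ x, ‖u x‖ ≤ C * Real.exp (|c.re| * |x|) :=
  ⟨_, fun x => by simpa using h.norm_le hV hc hc0 0 x⟩

end Growth

/-! ### Exponential weights -/

section Weight

theorem integrable_exp_neg_mul_abs {b : ℝ} (hb : 0 < b) :
    Integrable fun x : ℝ => Real.exp (-b * |x|) := by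
  rw [← integrableOn_univ, ← Iic_union_Ioi (a := (0 : ℝ)), integrableOn_union]
  constructor
  · refine (integrableOn_exp_mul_Iic hb 0).congr_fun (fun x hx => ?_) measurableSet_Iic
    simp only
    rw [abs_of_nonpos hx]; ring_nf
  · refine (integrableOn_exp_mul_Ioi (neg_lt_zero.2 hb) 0).congr_fun (fun x hx => ?_)
      measurableSet_Ioi
    simp only
    rw [abs_of_pos hx]

theorem memLp_exp_neg_mul_abs {b : ℝ} (hb : 0 < b) :
    MemLp (fun x : ℝ => Real.exp (-b * |x|)) 2 := by
  rw [memLp_two_iff_integrable_sq (by fun_prop)]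
  refine (integrable_exp_neg_mul_abs (b := 2 * b) (by positivity)).congr
    (Eventually.of_forall fun x => ?_)
  simp only
  rw [← Real.exp_nat_mul]
  ring_nf

variable {a b : ℝ} {f : ℝ → ℂ}

theorem MemWeightedL2.aestronglyMeasurable (hf : MemWeightedL2 a f) :
    AEStronglyMeasurable f := by
  have h : f = fun x : ℝ => (Real.exp (-a * |x|) : ℂ) * ((Real.exp (a * |x|) : ℂ) * f x) := by
    ext x
    rw [← mul_assoc, ← Complex.ofReal_mul, ← Real.exp_add]
    simp
  rw [h]
  exact AEStronglyMeasurable.mul (Continuous.aestronglyMeasurable (by fun_prop))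
    (MemLp.aestronglyMeasurable hf)

theorem MemWeightedL2.integrable_exp_mul (hf : MemWeightedL2 a f) (hb : b < a) :
    Integrable fun x : ℝ => Real.exp (b * |x|) * ‖f x‖ := by
  have h := (memLp_exp_neg_mul_abs (sub_pos.2 hb)).integrable_mul (MemLp.norm hf)
  refine h.congr (Eventually.of_forall fun x => ?_)
  simp only [Pi.mul_apply]
  rw [norm_mul, Complex.norm_real, Real.norm_of_nonneg (Real.exp_pos _).le, ← mul_assoc,
    ← Real.exp_add]
  ring_nf

theorem integrable_of_integrable_exp_mul (hf : AEStronglyMeasurable f) (hb : 0 ≤ b)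
    (h : Integrable fun x : ℝ => Real.exp (b * |x|) * ‖f x‖) : Integrable f :=
  h.mono' hf (Eventually.of_forall fun _ =>
    le_mul_of_one_le_left (norm_nonneg _) (Real.one_le_exp (by positivity)))

/-- The strict inequality b < a leaves the square-integrable factor e^{-(a-b)|x|}. -/
theorem memWeightedL2_neg_of_norm_le {C : ℝ} (hf : AEStronglyMeasurable f) (hb : b < a)
    (h : ∀ x, ‖f x‖ ≤ C * Real.exp (b * |x|)) : MemWeightedL2 (-a) f := by
  refine ((memLp_exp_neg_mul_abs (sub_pos.2 hb)).const_mul C).of_le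
    (AEStronglyMeasurable.mul (Continuous.aestronglyMeasurable (by fun_prop)) hf)
    (Eventually.of_forall fun x => ?_)
  rw [norm_mul, Complex.norm_real, Real.norm_of_nonneg (Real.exp_pos _).le]
  refine le_trans ?_ (le_abs_self _)
  calc Real.exp (-a * |x|) * ‖f x‖ ≤ Real.exp (-a * |x|) * (C * Real.exp (b * |x|)) := by
        gcongr; exact h x
    _ = C * (Real.exp (-a * |x|) * Real.exp (b * |x|)) := by ring
    _ = _ := by rw [← Real.exp_add]; ring_nf

/-- The weight e^{2a|x|} on V is shared out: one factor e^{a|x|} absorbs the growth of f, the other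
is the weight of X. -/
theorem memWeightedL2_mul_of_norm_le {V : ℝ → ℂ} {C : ℝ} (hV : MemWeightedL2 (2 * a) V)
    (hf : AEStronglyMeasurable f) (hb : b ≤ a)
    (h : ∀ x, ‖f x‖ ≤ C * Real.exp (b * |x|)) : MemWeightedL2 a (fun x => V x * f x) := by
  refine (MemLp.const_mul (MemLp.norm hV) C).of_le
    (AEStronglyMeasurable.mul (Continuous.aestronglyMeasurable (by fun_prop))
      (hV.aestronglyMeasurable.mul hf)) (Eventually.of_forall fun x => ?_)
  rw [norm_mul, norm_mul, Complex.norm_real, Real.norm_of_nonneg (Real.exp_pos _).le]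
  refine le_trans ?_ (le_abs_self _)
  rw [norm_mul, Complex.norm_real, Real.norm_of_nonneg (Real.exp_pos _).le]
  have hC : 0 ≤ C := by
    have := (norm_nonneg _).trans (h 0)
    simpa using this
  calc Real.exp (a * |x|) * (‖V x‖ * ‖f x‖)
      ≤ Real.exp (a * |x|) * (‖V x‖ * (C * Real.exp (a * |x|))) := by
        gcongr
        exact (h x).trans (by gcongr)
    _ = C * (Real.exp (a * |x|) * Real.exp (a * |x|) * ‖V x‖) := by ring
    _ = _ := by rw [← Real.exp_add]; ring_nf

end Weight

/-! ### The growing coefficients of a solution at `±∞` -/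

/-- `lim_{x → ∞} e^{-cx} (u' + c u)` for a solution `u` of `u'' = (V + c²) u`, computed from the
data of `u` at `x`. -/
noncomputable def coeffTop (V : ℝ → ℂ) (c : ℂ) (u : ℝ → ℂ) (x : ℝ) : ℂ :=
  Complex.exp (-c * x) * (deriv u x + c * u x) +
    ∫ y in Ioi x, Complex.exp (-c * y) * (V y * u y)

/-- `lim_{x → -∞} e^{cx} (u' - c u)` for a solution `u` of `u'' = (V + c²) u`, computed from the
data of `u` at `x`. -/
noncomputable def coeffBot (V : ℝ → ℂ) (c : ℂ) (u : ℝ → ℂ) (x : ℝ) : ℂ :=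
  Complex.exp (c * x) * (deriv u x - c * u x) -
    ∫ y in Iic x, Complex.exp (c * y) * (V y * u y)

section Coeff

variable {V : ℝ → ℂ} {lam c : ℂ} {u w : ℝ → ℂ} {b : ℝ}

/-- At +∞ the product e^{-cy}u(y) grows at rate |Re c| - Re c, which is 0 or -2 Re c according to
the sign of Re c; hence the condition on b. The factor e^{2|Re c||x|} pays for negative y when x <
0. -/
theorem integrableOn_Ioi_exp_mul (hV : AEStronglyMeasurable V)
    (hVb : Integrable fun x : ℝ => Real.exp (b * |x|) * ‖V x‖) (hu : AEStronglyMeasurable u)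
    {C : ℝ} (huC : ∀ x, ‖u x‖ ≤ C * Real.exp (|c.re| * |x|)) (hb : 0 ≤ b) (hcb : -(2 * c.re) ≤ b)
    (x : ℝ) : IntegrableOn (fun y : ℝ => Complex.exp (-c * y) * (V y * u y)) (Ioi x) := by
  refine (hVb.const_mul (C * Real.exp (2 * |c.re| * |x|))).integrableOn.mono'
    (AEStronglyMeasurable.mul (Continuous.aestronglyMeasurable (by fun_prop))
      (hV.mul hu)).restrict ?_
  filter_upwards [ae_restrict_mem measurableSet_Ioi] with y hy
  have hC : 0 ≤ C := by
    have := (norm_nonneg _).trans (huC 0)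
    simpa using this
  have hexp : -c.re * y + |c.re| * |y| ≤ 2 * |c.re| * |x| + b * |y| := by
    have hy' : x < y := hy
    rcases le_total 0 c.re with h | h
    · rw [abs_of_nonneg h]
      have h1 : |y| - y ≤ 2 * |x| := by
        rcases le_total 0 y with h0 | h0
        · rw [abs_of_nonneg h0]; linarith [abs_nonneg x]
        · rw [abs_of_nonpos h0]; linarith [neg_abs_le x]
      have := mul_le_mul_of_nonneg_left h1 h
      have h2 : 0 ≤ b * |y| := by positivity
      linarith
    · rw [abs_of_nonpos h]
      have h1 : -c.re * y ≤ -c.re * |y| := mul_le_mul_of_nonneg_left (le_abs_self y) (by linarith)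
      have h2 : -(2 * c.re) * |y| ≤ b * |y| := mul_le_mul_of_nonneg_right hcb (abs_nonneg y)
      have h3 : 0 ≤ 2 * -c.re * |x| := mul_nonneg (by linarith) (abs_nonneg _)
      linarith
  rw [norm_mul, norm_mul, Complex.norm_exp, Complex.re_mul_ofReal, Complex.neg_re]
  calc Real.exp (-c.re * y) * (‖V y‖ * ‖u y‖)
      ≤ Real.exp (-c.re * y) * (‖V y‖ * (C * Real.exp (|c.re| * |y|))) := by
        gcongr; exact huC y
    _ = C * ‖V y‖ * Real.exp (-c.re * y + |c.re| * |y|) := by rw [Real.exp_add]; ring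
    _ ≤ C * ‖V y‖ * Real.exp (2 * |c.re| * |x| + b * |y|) := by gcongr
    _ = _ := by rw [Real.exp_add]; ring

theorem integrableOn_Iic_exp_mul (hV : AEStronglyMeasurable V)
    (hVb : Integrable fun x : ℝ => Real.exp (b * |x|) * ‖V x‖) (hu : AEStronglyMeasurable u)
    {C : ℝ} (huC : ∀ x, ‖u x‖ ≤ C * Real.exp (|c.re| * |x|)) (hb : 0 ≤ b) (hcb : -(2 * c.re) ≤ b)
    (x : ℝ) : IntegrableOn (fun y : ℝ => Complex.exp (c * y) * (V y * u y)) (Iic x) := by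
  have hneg := (Measure.measurePreserving_neg (volume : Measure ℝ)).quasiMeasurePreserving
  have h := integrableOn_Ioi_exp_mul (V := fun x => V (-x)) (u := fun x => u (-x))
    (hV.comp_quasiMeasurePreserving hneg) (b := b) (by simpa using hVb.comp_neg)
    (hu.comp_quasiMeasurePreserving hneg) (c := c) (C := C)
    (fun x => by simpa using huC (-x)) hb hcb (-x)
  rw [← integrableOn_Ici_iff_integrableOn_Ioi, ← (Measure.measurePreserving_neg
    (volume : Measure ℝ)).integrableOn_comp_preimage (Homeomorph.neg ℝ).measurableEmbedding] at h
  refine (h.congr_fun (fun y _ => ?_) ?_).mono_set ?_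
  · simp
  · simp
  · simp

/-- The data common to the asymptotic analysis of a solution `u` of `u'' = (V + c²) u`. -/
structure IsTame (V : ℝ → ℂ) (c : ℂ) (u : ℝ → ℂ) : Prop where
  ne_zero : c ≠ 0
  isSolution : IsSolution V (-c ^ 2) u
  integrableOn_Ioi : ∀ x, IntegrableOn (fun y : ℝ => Complex.exp (-c * y) * (V y * u y)) (Ioi x)
  integrableOn_Iic : ∀ x, IntegrableOn (fun y : ℝ => Complex.exp (c * y) * (V y * u y)) (Iic x)

theorem IsSolution.isTame (h : IsSolution V (-c ^ 2) u) (hc0 : c ≠ 0)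
    (hV : AEStronglyMeasurable V) (hVb : Integrable fun x : ℝ => Real.exp (b * |x|) * ‖V x‖)
    (hb : 0 ≤ b) (hcb : -(2 * c.re) ≤ b) : IsTame V c u := by
  obtain ⟨C, hC⟩ := h.exists_norm_le (integrable_of_integrable_exp_mul hV hb hVb) (c := c)
    (by ring) hc0
  exact ⟨hc0, h, integrableOn_Ioi_exp_mul hV hVb h.continuous.aestronglyMeasurable hC hb hcb,
    integrableOn_Iic_exp_mul hV hVb h.continuous.aestronglyMeasurable hC hb hcb⟩

/-- The change of the boundary term from x₀ to x is exactly the piece of the tail integral that is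
lost. -/
theorem IsTame.coeffTop_eq (h : IsTame V c u) (x₀ x : ℝ) :
    coeffTop V c u x = coeffTop V c u x₀ := by
  have h1 := (h.isSolution.isPrimitive_exp_mul (c := c) (by ring)).integral_eq x₀ x
  have h2 := integral_Ioi_sub_Ioi' (h.integrableOn_Ioi x₀) (h.integrableOn_Ioi x)
  rw [h1] at h2
  unfold coeffTop
  linear_combination -h2

theorem IsTame.coeffBot_eq (h : IsTame V c u) (x₀ x : ℝ) :
    coeffBot V c u x = coeffBot V c u x₀ := by
  have h1 := (h.isSolution.isPrimitive_exp_mul (c := -c) (by ring)).integral_eq x₀ x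
  simp only [neg_neg] at h1
  have h2 := integral_Iic_sub_Iic (h.integrableOn_Iic x₀) (h.integrableOn_Iic x)
  rw [h1] at h2
  unfold coeffBot
  linear_combination -h2

theorem IsTame.tendsto_top (h : IsTame V c u) (x₀ : ℝ) :
    Tendsto (fun x : ℝ => Complex.exp (-c * x) * (deriv u x + c * u x)) atTop
      (𝓝 (coeffTop V c u x₀)) := by
  have h1 := intervalIntegral_tendsto_integral_Ioi x₀ (h.integrableOn_Ioi x₀) tendsto_id
  refine (h1.const_add (Complex.exp (-c * x₀) * (deriv u x₀ + c * u x₀))).congr fun x => ?_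
  exact ((h.isSolution.isPrimitive_exp_mul (c := c) (by ring)).eq_add x₀ x).symm

theorem IsTame.tendsto_bot (h : IsTame V c u) (x₀ : ℝ) :
    Tendsto (fun x : ℝ => Complex.exp (c * x) * (deriv u x - c * u x)) atBot
      (𝓝 (coeffBot V c u x₀)) := by
  have h1 := intervalIntegral_tendsto_integral_Iic x₀ (h.integrableOn_Iic x₀) tendsto_id
  refine (h1.const_sub (Complex.exp (c * x₀) * (deriv u x₀ - c * u x₀))).congr fun x => ?_
  have := (h.isSolution.isPrimitive_exp_mul (c := -c) (by ring)).eq_add x x₀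
  simp only [neg_neg] at this
  simp only [id_eq]
  linear_combination this

/-- With both coefficients computed at x itself, the terms in u' cancel and those in u add up to
2cu. Their independence of the base point then lets x₀ be fixed. -/
theorem IsTame.D_eq {k : ℂ} (h : IsTame V (Complex.I * k) u) (x₀ x : ℝ) :
    D V k u x = 1 / (2 * (Complex.I * k)) *
      (Complex.exp (Complex.I * k * x) * coeffTop V (Complex.I * k) u x₀ -
        Complex.exp (-(Complex.I * k) * x) * coeffBot V (Complex.I * k) u x₀) := by
  have hc0 := h.ne_zero
  rw [← h.coeffTop_eq x₀ x, ← h.coeffBot_eq x₀ x]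
  unfold D coeffTop coeffBot
  generalize Complex.I * k = c at *
  have e1 : ∫ y in Ioi x, Complex.exp (-c * (y - x)) * V y * u y =
      Complex.exp (c * x) * ∫ y in Ioi x, Complex.exp (-c * y) * (V y * u y) := by
    rw [← MeasureTheory.integral_const_mul]
    refine MeasureTheory.integral_congr_ae (Eventually.of_forall fun y => ?_)
    simp only
    rw [← mul_assoc (Complex.exp _), ← Complex.exp_add, mul_assoc]
    ring_nf
  have e2 : ∫ y in Iic x, Complex.exp (c * (y - x)) * V y * u y =
      Complex.exp (-c * x) * ∫ y in Iic x, Complex.exp (c * y) * (V y * u y) := by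
    rw [← MeasureTheory.integral_const_mul]
    refine MeasureTheory.integral_congr_ae (Eventually.of_forall fun y => ?_)
    simp only
    rw [← mul_assoc (Complex.exp _), ← Complex.exp_add, mul_assoc]
    ring_nf
  have e3 : Complex.exp (c * x) * Complex.exp (-c * x) = 1 := by
    rw [← Complex.exp_add]; simp
  rw [e1, e2]
  generalize Complex.exp (c * x) = X at *
  generalize Complex.exp (-c * x) = Y at *
  field_simp
  linear_combination (-2 * c * u x) * e3

theorem IsTame.hasDerivAt_D {k : ℂ} (h : IsTame V (Complex.I * k) u) (x₀ x : ℝ) :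
    HasDerivAt (D V k u) (1 / 2 *
      (Complex.exp (Complex.I * k * x) * coeffTop V (Complex.I * k) u x₀ +
        Complex.exp (-(Complex.I * k) * x) * coeffBot V (Complex.I * k) u x₀)) x := by
  have h1 : D V k u = fun x : ℝ => 1 / (2 * (Complex.I * k)) *
      (Complex.exp (Complex.I * k * x) * coeffTop V (Complex.I * k) u x₀ -
        Complex.exp (-(Complex.I * k) * x) * coeffBot V (Complex.I * k) u x₀) :=
    funext fun x => h.D_eq x₀ x
  rw [h1]
  have hc0 := h.ne_zero
  generalize Complex.I * k = c at *
  refine ((((hasDerivAt_cexp_mul_ofReal c x).mul_const _).sub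
    ((hasDerivAt_cexp_mul_ofReal (-c) x).mul_const _)).const_mul _).congr_deriv ?_
  generalize Complex.exp (c * x) = X at *
  generalize Complex.exp (-c * x) = Y at *
  field_simp
  ring

theorem IsTame.dWellDefined {k : ℂ} (h : IsTame V (Complex.I * k) u) : DWellDefined V k u := by
  refine ⟨fun x => ?_, fun x => ?_, fun x => (h.hasDerivAt_D 0 x).differentiableAt⟩
  · refine IntegrableOn.congr_fun ((h.integrableOn_Ioi x).const_mul
      (Complex.exp (Complex.I * k * x))) (fun y _ => ?_) measurableSet_Ioi
    rw [← mul_assoc (Complex.exp _), ← Complex.exp_add, mul_assoc]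
    ring_nf
  · refine IntegrableOn.congr_fun ((h.integrableOn_Iic x).const_mul
      (Complex.exp (-(Complex.I * k) * x))) (fun y _ => ?_) measurableSet_Iic
    rw [← mul_assoc (Complex.exp _), ← Complex.exp_add, mul_assoc]
    ring_nf

/-- Only the mixed products e^{cx}e^{-cx} = 1 survive in the determinant, which is why x disappears.
-/
theorem IsTame.detD_eq {k : ℂ} (hu : IsTame V (Complex.I * k) u)
    (hw : IsTame V (Complex.I * k) w) (x₀ x : ℝ) :
    detD V k u w x = 1 / (2 * (Complex.I * k)) *
      (coeffTop V (Complex.I * k) u x₀ * coeffBot V (Complex.I * k) w x₀ -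
        coeffBot V (Complex.I * k) u x₀ * coeffTop V (Complex.I * k) w x₀) := by
  unfold detD
  rw [Matrix.det_fin_two_of, hu.D_eq x₀, hw.D_eq x₀, (hu.hasDerivAt_D x₀ x).deriv,
    (hw.hasDerivAt_D x₀ x).deriv]
  have e3 : Complex.exp (Complex.I * k * x) * Complex.exp (-(Complex.I * k) * x) = 1 := by
    rw [← Complex.exp_add]; simp
  linear_combination (1 / (2 * (Complex.I * k)) *
    (coeffTop V (Complex.I * k) u x₀ * coeffBot V (Complex.I * k) w x₀ -
        coeffBot V (Complex.I * k) u x₀ * coeffTop V (Complex.I * k) w x₀)) * e3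

end Coeff

end ExpDecaySchrodinger

namespace ExpDecaySchrodinger

open MeasureTheory Set Filter Topology intervalIntegral

/-! ### Variation of constants and tail integrals -/

theorem IsPrimitive.comp_neg {F f : ℝ → ℂ} (h : IsPrimitive F f) :
    IsPrimitive (fun x => F (-x)) (fun x => -f (-x)) := fun x y => by
  constructor
  · have := (IntervalIntegrable.iff_comp_neg (f := f) (a := -x) (b := -y)).1
      (h.intervalIntegrable _ _)
    simp only [neg_neg] at this
    exact this.neg
  · rw [intervalIntegral.integral_neg, intervalIntegral.integral_comp_neg (fun t => f t),
      h.integral_eq]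
    ring

theorem isPrimitive_integral_Ioi {q : ℝ → ℂ} (hq : ∀ x, IntegrableOn q (Ioi x)) :
    IsPrimitive (fun x => ∫ t in Ioi x, q t) (fun x => -q x) := fun x y => by
  have hi : IntervalIntegrable q volume x y := by
    rw [intervalIntegrable_iff]
    exact (hq (min x y)).mono_set fun t ht => ht.1
  refine ⟨hi.neg, ?_⟩
  rw [intervalIntegral.integral_neg, ← integral_Ioi_sub_Ioi' (hq x) (hq y)]
  ring

theorem isPrimitive_integral_Iic {q : ℝ → ℂ} (hq : ∀ x, IntegrableOn q (Iic x)) :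
    IsPrimitive (fun x => ∫ t in Iic x, q t) q := fun x y => by
  have hi : IntervalIntegrable q volume x y := by
    rw [intervalIntegrable_iff]
    exact (hq (max x y)).mono_set fun t ht => ht.2
  exact ⟨hi, (integral_Iic_sub_Iic (hq x) (hq y)).symm⟩

theorem tendsto_integral_Ioi_atTop {E : Type*} [NormedAddCommGroup E] [NormedSpace ℝ E]
    {q : ℝ → E} (hq : Integrable q) :
    Tendsto (fun x => ∫ t in Ioi x, q t) atTop (𝓝 0) := by
  have h := (intervalIntegral_tendsto_integral_Ioi 0 hq.integrableOn tendsto_id).const_sub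
    (∫ t in Ioi 0, q t)
  rw [sub_self] at h
  refine h.congr fun x => ?_
  rw [id_eq, ← integral_Ioi_sub_Ioi' hq.integrableOn hq.integrableOn, sub_sub_cancel]

/-- Variation of constants for y'' = c²y + q. It yields both the Jost solutions and the equation
satisfied by A(λ)ψ; only the integration constants in A and B differ. -/
theorem isPrimitive_variation {c : ℂ} (hc : c ≠ 0) {A B q : ℝ → ℂ}
    (hA : IsPrimitive A (fun x : ℝ => Complex.exp (-c * x) * q x))
    (hB : IsPrimitive B (fun x : ℝ => Complex.exp (c * x) * q x)) :
    IsPrimitive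
      (fun x : ℝ => 1 / (2 * c) * (Complex.exp (c * x) * A x - Complex.exp (-c * x) * B x))
      (fun x : ℝ => 1 / 2 * (Complex.exp (c * x) * A x + Complex.exp (-c * x) * B x)) ∧
    IsPrimitive
      (fun x : ℝ => 1 / 2 * (Complex.exp (c * x) * A x + Complex.exp (-c * x) * B x))
      (fun x : ℝ => q x + c ^ 2 *
        (1 / (2 * c) * (Complex.exp (c * x) * A x - Complex.exp (-c * x) * B x))) := by
  have h1 := (isPrimitive_cexp c).mul hA
  have h2 := (isPrimitive_cexp (-c)).mul hB
  have e : ∀ x : ℝ, Complex.exp (c * x) * Complex.exp (-c * x) = 1 := fun x => by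
    rw [← Complex.exp_add]; simp
  constructor
  · refine ((h1.sub h2).const_mul (1 / (2 * c))).congr_right (funext fun x => ?_)
    have := e x
    generalize Complex.exp (c * x) = X at *
    generalize Complex.exp (-c * x) = Y at *
    field_simp
    ring
  · refine ((h1.add h2).const_mul (1 / 2)).congr_right (funext fun x => ?_)
    have := e x
    generalize Complex.exp (c * x) = X at *
    generalize Complex.exp (-c * x) = Y at *
    field_simp
    linear_combination 2 * q x * this

/-! ### Jost solutions -/

section Jost

theorem norm_cexp_neg_two_mul_le_one {c : ℂ} (hc : 0 < c.re) {x t : ℝ} (ht : t ∈ Ioi x) :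
    ‖Complex.exp (-(2 * c) * (t - x))‖ ≤ 1 := by
  rw [Complex.norm_exp, ← Complex.ofReal_sub, Complex.re_mul_ofReal, Real.exp_le_one_iff]
  have : 0 < t - x := sub_pos.2 ht
  simp only [Complex.neg_re, Complex.mul_re, Complex.re_ofNat, Complex.im_ofNat, zero_mul,
    sub_zero]
  nlinarith

theorem integrableOn_cexp_mul {c : ℂ} (hc : 0 < c.re) {q : ℝ → ℂ} (hq : Integrable q) (x : ℝ) :
    IntegrableOn (fun t : ℝ => Complex.exp (-(2 * c) * (t - x)) * q t) (Ioi x) :=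
  hq.integrableOn.bdd_mul (c := 1) (Continuous.aestronglyMeasurable (by fun_prop))
    (by filter_upwards [ae_restrict_mem measurableSet_Ioi] with t ht
          using norm_cexp_neg_two_mul_le_one hc ht)

theorem norm_integral_cexp_mul_le {c : ℂ} (hc : 0 < c.re) {q : ℝ → ℂ} (hq : Integrable q)
    (x : ℝ) : ‖∫ t in Ioi x, Complex.exp (-(2 * c) * (t - x)) * q t‖ ≤ ∫ t in Ioi x, ‖q t‖ := by
  refine norm_integral_le_of_norm_le hq.norm.integrableOn ?_
  filter_upwards [ae_restrict_mem measurableSet_Ioi] with t ht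
  rw [norm_mul]
  exact mul_le_of_le_one_left (norm_nonneg _) (norm_cexp_neg_two_mul_le_one hc ht)

theorem integral_cexp_mul_eq (c : ℂ) (q : ℝ → ℂ) (x : ℝ) :
    ∫ t in Ioi x, Complex.exp (-(2 * c) * (t - x)) * q t =
      Complex.exp (2 * c * x) * ∫ t in Ioi x, Complex.exp (-(2 * c) * t) * q t := by
  rw [← MeasureTheory.integral_const_mul]
  refine MeasureTheory.integral_congr_ae (Eventually.of_forall fun t => ?_)
  simp only
  rw [← mul_assoc, ← Complex.exp_add]
  ring_nf

theorem integrableOn_cexp_mul' {c : ℂ} (hc : 0 < c.re) {q : ℝ → ℂ} (hq : Integrable q) (x : ℝ) :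
    IntegrableOn (fun t : ℝ => Complex.exp (-(2 * c) * t) * q t) (Ioi x) := by
  refine IntegrableOn.congr_fun ((integrableOn_cexp_mul hc hq x).const_mul
    (Complex.exp (-(2 * c) * x))) (fun t _ => ?_) measurableSet_Ioi
  rw [← mul_assoc, ← Complex.exp_add]
  ring_nf

/-- The Volterra equation at `+∞` for the Jost solution of a small potential. -/
theorem exists_volterra_fixedPoint {c : ℂ} (hc : 0 < c.re) {g : ℝ → ℂ} (hg : Integrable g)
    (hsmall : ∫ t, ‖g t‖ < ‖c‖) :
    ∃ h : ℝ → ℂ, Integrable (fun t => g t * h t) ∧ ∀ x, h x = 1 + 1 / (2 * c) *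
      ((∫ t in Ioi x, g t * h t) -
        ∫ t in Ioi x, Complex.exp (-(2 * c) * (t - x)) * (g t * h t)) := by
  have hcn : 0 < ‖c‖ := (norm_nonneg _).lt_of_ne fun h0 => by
    rw [norm_eq_zero.1 h0.symm] at hc
    simp at hc
  have hgh : ∀ h : BoundedContinuousFunction ℝ ℂ, Integrable fun t => g t * h t := fun h =>
    hg.mul_bdd (c := ‖h‖) h.continuous.aestronglyMeasurable
      (Eventually.of_forall fun t => h.norm_coe_le_norm t)
  have hnorm : ∀ q : ℝ → ℂ, Integrable q → ∀ x, ‖1 / (2 * c) * ((∫ t in Ioi x, q t) -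
      ∫ t in Ioi x, Complex.exp (-(2 * c) * (t - x)) * q t)‖ ≤ (∫ t, ‖q t‖) / ‖c‖ := by
    intro q hq x
    have h1 : ‖∫ t in Ioi x, q t‖ ≤ ∫ t, ‖q t‖ := (MeasureTheory.norm_integral_le_integral_norm _).trans
      (setIntegral_le_integral hq.norm (Eventually.of_forall fun t => norm_nonneg _))
    have h2 := (norm_integral_cexp_mul_le hc hq x).trans
      (setIntegral_le_integral hq.norm (Eventually.of_forall fun t => norm_nonneg _))
    have h3 := (norm_sub_le _ _).trans (add_le_add h1 h2)
    rw [norm_mul, norm_div, norm_one, norm_mul, Complex.norm_two]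
    calc _ ≤ 1 / (2 * ‖c‖) * ((∫ t, ‖q t‖) + ∫ t, ‖q t‖) := by gcongr
      _ = _ := by field_simp; ring
  have hcont : ∀ q : ℝ → ℂ, Integrable q → Continuous fun x : ℝ => 1 / (2 * c) *
      ((∫ t in Ioi x, q t) - ∫ t in Ioi x, Complex.exp (-(2 * c) * (t - x)) * q t) := by
    intro q hq
    simp only [integral_cexp_mul_eq]
    have h1 := (isPrimitive_integral_Ioi fun x => hq.integrableOn (s := Ioi x)).continuous
    have h2 := (isPrimitive_integral_Ioi (integrableOn_cexp_mul' hc hq)).continuous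
    fun_prop
  have hmaj : ∀ h : BoundedContinuousFunction ℝ ℂ,
      ∫ t, ‖g t * h t‖ ≤ (∫ t, ‖g t‖) * ‖h‖ := by
    intro h
    rw [← MeasureTheory.integral_mul_const]
    refine integral_mono (hgh h).norm (hg.norm.mul_const _) fun t => ?_
    simp only [norm_mul]
    gcongr
    exact h.norm_coe_le_norm t
  set T : BoundedContinuousFunction ℝ ℂ → BoundedContinuousFunction ℝ ℂ := fun h =>
    BoundedContinuousFunction.ofNormedAddCommGroup (fun x : ℝ => 1 + 1 / (2 * c) *
      ((∫ t in Ioi x, g t * h t) -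
        ∫ t in Ioi x, Complex.exp (-(2 * c) * (t - x)) * (g t * h t)))
      (continuous_const.add (hcont _ (hgh h))) (1 + (∫ t, ‖g t * h t‖) / ‖c‖)
      (fun x => (norm_add_le _ _).trans (by
        rw [norm_one]
        gcongr
        exact hnorm _ (hgh h) x)) with hT
  -- Two integrals, each at most ∫‖g‖ times the sup norm, with prefactor 1/(2‖c‖); the smallness
  -- hypothesis says K < 1.
  set K : ℝ := (∫ t, ‖g t‖) / ‖c‖ with hK
  have hK0 : 0 ≤ K := div_nonneg (integral_nonneg fun t => norm_nonneg _) hcn.le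
  have hcontr : ContractingWith K.toNNReal T := by
    refine ⟨?_, LipschitzWith.of_dist_le_mul fun h₁ h₂ => ?_⟩
    · exact Real.toNNReal_lt_one.2 ((div_lt_one hcn).2 hsmall)
    · rw [Real.coe_toNNReal _ hK0]
      refine (BoundedContinuousFunction.dist_le (mul_nonneg hK0 dist_nonneg)).2 fun x => ?_
      have e : T h₁ x - T h₂ x = 1 / (2 * c) * ((∫ t in Ioi x, g t * (h₁ - h₂) t) -
          ∫ t in Ioi x, Complex.exp (-(2 * c) * (t - x)) * (g t * (h₁ - h₂) t)) := by
        have e1 : ∫ t in Ioi x, g t * (h₁ - h₂) t =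
            (∫ t in Ioi x, g t * h₁ t) - ∫ t in Ioi x, g t * h₂ t := by
          rw [← MeasureTheory.integral_sub (hgh h₁).integrableOn (hgh h₂).integrableOn]
          simp [mul_sub]
        have e2 : ∫ t in Ioi x, Complex.exp (-(2 * c) * (t - x)) * (g t * (h₁ - h₂) t) =
            (∫ t in Ioi x, Complex.exp (-(2 * c) * (t - x)) * (g t * h₁ t)) -
            ∫ t in Ioi x, Complex.exp (-(2 * c) * (t - x)) * (g t * h₂ t) := by
          rw [← MeasureTheory.integral_sub (integrableOn_cexp_mul hc (hgh h₁) x)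
            (integrableOn_cexp_mul hc (hgh h₂) x)]
          simp [mul_sub]
        rw [e1, e2]
        simp only [hT, BoundedContinuousFunction.coe_ofNormedAddCommGroup]
        ring
      rw [dist_eq_norm, e, dist_eq_norm]
      refine (hnorm _ (hgh _) x).trans ?_
      rw [hK, div_mul_eq_mul_div]
      gcongr
      exact hmaj _
  refine ⟨hcontr.fixedPoint, hgh _, fun x => ?_⟩
  have hfix : T hcontr.fixedPoint = hcontr.fixedPoint := hcontr.fixedPoint_isFixedPt
  have := congrArg (fun h : BoundedContinuousFunction ℝ ℂ => h x) hfix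
  exact this.symm

variable {V : ℝ → ℂ} {c : ℂ}

/-- The Volterra equation is the one satisfied by h = u e^{cx}, so u is rebuilt from the fixed point
h by variation of constants. -/
theorem exists_jost_of_small (hc : 0 < c.re) (hV : Integrable V) (hsmall : ∫ t, ‖V t‖ < ‖c‖) :
    ∃ u : ℝ → ℂ, IsSolution V (-c ^ 2) u ∧
      Tendsto (fun x : ℝ => u x * Complex.exp (c * x)) atTop (𝓝 1) ∧
      Tendsto (fun x : ℝ => deriv u x * Complex.exp (c * x)) atTop (𝓝 (-c)) := by
  have hc0 : c ≠ 0 := by rintro rfl; simp at hc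
  obtain ⟨h, hint, hh⟩ := exists_volterra_fixedPoint hc hV hsmall
  set q : ℝ → ℂ := fun t => Complex.exp (-c * t) * (V t * h t) with hq
  have e : ∀ x : ℝ, Complex.exp (c * x) * Complex.exp (-c * x) = 1 := fun x => by
    rw [← Complex.exp_add]; simp
  have e2 : ∀ x : ℝ, Complex.exp (2 * c * x) = Complex.exp (c * x) * Complex.exp (c * x) :=
    fun x => by rw [← Complex.exp_add]; ring_nf
  have e3 : ∀ x : ℝ, Complex.exp (-(2 * c) * x) = Complex.exp (-c * x) * Complex.exp (-c * x) :=
    fun x => by rw [← Complex.exp_add]; ring_nf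
  -- Constants of integration fixed at +∞: A → 0 removes the growing exponential, and B → -2c
  -- normalizes u to e^{-cx}.
  set A : ℝ → ℂ := fun x => -∫ t in Ioi x, Complex.exp (-(2 * c) * t) * (V t * h t) with hA
  set B : ℝ → ℂ := fun x => -(2 * c) - ∫ t in Ioi x, V t * h t with hB
  have hAp : IsPrimitive A (fun x : ℝ => Complex.exp (-c * x) * q x) := by
    have := (isPrimitive_integral_Ioi (integrableOn_cexp_mul' hc hint)).const_mul (-1)
    refine (this.congr_right (funext fun x => ?_)).congr_left (funext fun x => ?_)
    · rw [e3]; simp only [hq]; ring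
    · simp only [hA]; ring
  have hBp : IsPrimitive B (fun x : ℝ => Complex.exp (c * x) * q x) := by
    have := (isPrimitive_const (-(2 * c))).sub
      (isPrimitive_integral_Ioi fun x => hint.integrableOn (s := Ioi x))
    refine this.congr_right (funext fun x => ?_)
    simp only [hq]
    linear_combination (-V x * h x) * e x
  obtain ⟨h1, h2⟩ := isPrimitive_variation hc0 hAp hBp
  set u : ℝ → ℂ :=
    fun x => 1 / (2 * c) * (Complex.exp (c * x) * A x - Complex.exp (-c * x) * B x) with hu
  have huh : ∀ x, u x * Complex.exp (c * x) = h x := by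
    intro x
    rw [hh x, integral_cexp_mul_eq, e2]
    have := e x
    simp only [hu, hA, hB]
    generalize Complex.exp (c * x) = X at *
    generalize Complex.exp (-c * x) = Y at *
    field_simp
    linear_combination (2 * c + ∫ t in Ioi x, V t * h t) * this
  have huq : ∀ x, q x = V x * u x := by
    intro x
    simp only [hq]
    rw [← huh x]
    linear_combination (V x * u x) * e x
  obtain ⟨hs, hd⟩ := isSolution_of_isPrimitive (V := V) (lam := -c ^ 2) h1
    (h2.congr_right (funext fun x => by rw [huq x]; ring))
  have t1 := tendsto_integral_Ioi_atTop hint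
  have t2 : Tendsto (fun x : ℝ => ∫ t in Ioi x, Complex.exp (-(2 * c) * (t - x)) * (V t * h t))
      atTop (𝓝 0) :=
    squeeze_zero_norm (norm_integral_cexp_mul_le hc hint) (tendsto_integral_Ioi_atTop hint.norm)
  refine ⟨u, hs, ?_, ?_⟩
  · simp only [huh]
    have := ((t1.sub t2).const_mul (1 / (2 * c))).const_add 1
    simp only [sub_zero, mul_zero, add_zero] at this
    exact this.congr fun x => (hh x).symm
  · have := ((t2.neg).sub (t1.const_add (2 * c))).const_mul (1 / 2)
    have e4 : (1 / 2 * (-0 - (2 * c + 0)) : ℂ) = -c := by ring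
    rw [e4] at this
    refine this.congr fun x => ?_
    rw [hd, integral_cexp_mul_eq, e2]
    simp only [hA, hB]
    linear_combination (1 / 2 * (2 * c + ∫ t in Ioi x, V t * h t)) * e x

/-- Only the behaviour at +∞ matters: beyond a large T the potential has small integral, and the
Jost solution found there is continued to the whole line by the initial value problem at T. -/
theorem exists_jost (hc : 0 < c.re) (hV : Integrable V) :
    ∃ u : ℝ → ℂ, IsSolution V (-c ^ 2) u ∧
      Tendsto (fun x : ℝ => u x * Complex.exp (c * x)) atTop (𝓝 1) ∧
      Tendsto (fun x : ℝ => deriv u x * Complex.exp (c * x)) atTop (𝓝 (-c)) := by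
  have hcn : 0 < ‖c‖ := norm_pos_iff.2 (by rintro rfl; simp at hc)
  obtain ⟨T, hT⟩ := ((tendsto_integral_Ioi_atTop hV.norm).eventually_lt_const hcn).exists
  obtain ⟨u, hu, hu1, hu2⟩ := exists_jost_of_small (V := (Ioi T).indicator V) hc
    (hV.indicator measurableSet_Ioi) (by
      simp only [norm_indicator_eq_indicator_norm]
      rwa [MeasureTheory.integral_indicator measurableSet_Ioi])
  have hVi : ∀ x y, IntervalIntegrable V volume x y := fun x y => hV.intervalIntegrable
  obtain ⟨y, hy, -⟩ := exists_isSolution hVi T (u T) (deriv u T)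
  obtain ⟨hs, h0, h1⟩ := hy (-c ^ 2)
  have heq : ∀ x, T ≤ x → y (-c ^ 2) x = u x := fun x hx =>
    hs.eq_of_eqOn hu hVi (fun t ht => by
      rw [uIoc_of_le hx] at ht
      rw [indicator_of_mem (show t ∈ Ioi T from ht.1)]) h0 h1
  refine ⟨y (-c ^ 2), hs, hu1.congr' ?_, hu2.congr' ?_⟩
  · filter_upwards [eventually_ge_atTop T] with x hx
    rw [heq x hx]
  · filter_upwards [eventually_gt_atTop T] with x hx
    have : y (-c ^ 2) =ᶠ[𝓝 x] u := by
      filter_upwards [Ioi_mem_nhds hx] with z hz using heq z (le_of_lt hz)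
    rw [this.deriv_eq]

theorem IsSolution.comp_neg {lam : ℂ} {u : ℝ → ℂ} (h : IsSolution V lam u) :
    IsSolution (fun x => V (-x)) lam (fun x => u (-x)) ∧
      deriv (fun x => u (-x)) = fun x => -deriv u (-x) :=
  isSolution_of_isPrimitive h.isPrimitive.comp_neg
    ((h.isPrimitive_deriv.comp_neg.const_mul (-1)).congr_left (by ext; ring) |>.congr_right
      (by ext; ring))

theorem exists_isMuPlus {k : ℂ} (hk : k.im < 0) (hV : Integrable V) : ∃ u, IsMuPlus V k u := by
  obtain ⟨u, h1, h2, h3⟩ := exists_jost (c := Complex.I * k) (by simpa using hk) hV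
  have : -(Complex.I * k) ^ 2 = k ^ 2 := by rw [mul_pow, Complex.I_sq]; ring
  rw [this] at h1
  exact ⟨u, h1, h2, h3⟩

theorem exists_isMuMinus {k : ℂ} (hk : k.im < 0) (hV : Integrable V) :
    ∃ u, IsMuMinus V k u := by
  obtain ⟨u, h1, h2, h3⟩ := exists_isMuPlus hk hV.comp_neg
  obtain ⟨h4, h5⟩ := h1.comp_neg
  simp only [neg_neg] at h4
  refine ⟨fun x => u (-x), h4, ?_, ?_⟩
  · refine (h2.comp tendsto_neg_atBot_atTop).congr fun x => ?_
    simp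
  · have := (h3.comp tendsto_neg_atBot_atTop).neg
    rw [neg_neg] at this
    refine this.congr fun x => ?_
    rw [h5]
    simp

end Jost

/-! ### The Evans function -/

section Evans

variable {V : ℝ → ℂ} {lam k : ℂ} {u w : ℝ → ℂ}

theorem IsSolution.wronskian_eq (hu : IsSolution V lam u) (hw : IsSolution V lam w) (x y : ℝ) :
    u x * deriv w x - deriv u x * w x = u y * deriv w y - deriv u y * w y := by
  have h := ((hu.isPrimitive.mul hw.isPrimitive_deriv).sub
    (hu.isPrimitive_deriv.mul hw.isPrimitive)).congr_right (g := fun _ => 0)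
    (funext fun x => by ring)
  have := h.integral_eq y x
  simp only [intervalIntegral.integral_zero] at this
  exact (sub_eq_zero.1 this.symm)

/-- The constant Wronskian is evaluated at +∞ as (u e^{cx})·e^{-cx}(w' + cw) - (u' +
cu)e^{cx}·e^{-cx}w. The first product tends to p(w); the second is a null factor times a bounded
one. -/
theorem IsMuPlus.wronskian_eq (hu : IsMuPlus V k u) (hV : Integrable V) (hk : k.im < 0)
    (hw : IsTame V (Complex.I * k) w) (x₀ : ℝ) :
    u x₀ * deriv w x₀ - deriv u x₀ * w x₀ = coeffTop V (Complex.I * k) w x₀ := by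
  obtain ⟨h1, h2, h3⟩ := hu
  have hlam : -(Complex.I * k) ^ 2 = k ^ 2 := by rw [mul_pow, Complex.I_sq]; ring
  have hws := hlam ▸ hw.isSolution
  obtain ⟨C, hC⟩ := hw.isSolution.exists_norm_le hV (c := Complex.I * k) (by ring) hw.ne_zero
  have hbdd : IsBoundedUnder (· ≤ ·) atTop
      (fun x : ℝ => ‖Complex.exp (-(Complex.I * k) * x) * w x‖) := by
    refine isBoundedUnder_of_eventually_le (a := C) ?_
    filter_upwards [eventually_ge_atTop 0] with x hx
    rw [norm_mul, Complex.norm_exp, Complex.re_mul_ofReal]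
    refine (mul_le_mul_of_nonneg_left (hC x) (Real.exp_pos _).le).trans_eq ?_
    rw [mul_left_comm, ← Real.exp_add, abs_of_nonneg hx]
    simp [abs_of_neg hk]
  have h4 : Tendsto (fun x : ℝ => deriv u x * Complex.exp (Complex.I * k * x) +
      Complex.I * k * (u x * Complex.exp (Complex.I * k * x))) atTop (𝓝 0) := by
    have := h3.add (h2.const_mul (Complex.I * k))
    simpa using this
  have h5 := (h2.mul (hw.tendsto_top x₀)).sub (h4.zero_mul_isBoundedUnder_le hbdd)
  rw [one_mul, sub_zero] at h5
  refine tendsto_nhds_unique (tendsto_const_nhds.congr fun x => ?_) h5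
  rw [h1.wronskian_eq hws x₀ x]
  have e : Complex.exp (Complex.I * k * x) * Complex.exp (-(Complex.I * k) * x) = 1 := by
    rw [← Complex.exp_add]; simp
  linear_combination (-(u x * deriv w x - deriv u x * w x)) * e

theorem IsMuMinus.wronskian_eq (hu : IsMuMinus V k u) (hV : Integrable V) (hk : k.im < 0)
    (hw : IsTame V (Complex.I * k) w) (x₀ : ℝ) :
    u x₀ * deriv w x₀ - deriv u x₀ * w x₀ = coeffBot V (Complex.I * k) w x₀ := by
  obtain ⟨h1, h2, h3⟩ := hu
  have hlam : -(Complex.I * k) ^ 2 = k ^ 2 := by rw [mul_pow, Complex.I_sq]; ring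
  have hws := hlam ▸ hw.isSolution
  obtain ⟨C, hC⟩ := hw.isSolution.exists_norm_le hV (c := Complex.I * k) (by ring) hw.ne_zero
  have hbdd : IsBoundedUnder (· ≤ ·) atBot
      (fun x : ℝ => ‖Complex.exp (Complex.I * k * x) * w x‖) := by
    refine isBoundedUnder_of_eventually_le (a := C) ?_
    filter_upwards [eventually_le_atBot 0] with x hx
    rw [norm_mul, Complex.norm_exp, Complex.re_mul_ofReal]
    refine (mul_le_mul_of_nonneg_left (hC x) (Real.exp_pos _).le).trans_eq ?_
    rw [mul_left_comm, ← Real.exp_add, abs_of_nonpos hx]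
    simp [abs_of_neg hk]
  have h4 : Tendsto (fun x : ℝ => deriv u x * Complex.exp (-(Complex.I * k * x)) -
      Complex.I * k * (u x * Complex.exp (-(Complex.I * k * x)))) atBot (𝓝 0) := by
    have := h3.sub (h2.const_mul (Complex.I * k))
    simpa using this
  have h5 := (h2.mul (hw.tendsto_bot x₀)).sub (h4.zero_mul_isBoundedUnder_le hbdd)
  rw [one_mul, sub_zero] at h5
  refine tendsto_nhds_unique (tendsto_const_nhds.congr fun x => ?_) h5
  rw [h1.wronskian_eq hws x₀ x]
  have e : Complex.exp (Complex.I * k * x) * Complex.exp (-(Complex.I * k * x)) = 1 := by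
    rw [← Complex.exp_add]; simp
  linear_combination (-(u x * deriv w x - deriv u x * w x)) * e

theorem isEvansValue (hV : Integrable V) (hk : k.im < 0) {x₀ : ℝ} {ν₁ ν₂ : ℝ → ℂ}
    (h₁ : IsTame V (Complex.I * k) ν₁) (h₂ : IsTame V (Complex.I * k) ν₂)
    (h10 : ν₁ x₀ = 1) (h11 : deriv ν₁ x₀ = 0) (h20 : ν₂ x₀ = 0) (h21 : deriv ν₂ x₀ = 1) :
    IsEvansValue V k (coeffTop V (Complex.I * k) ν₁ x₀ * coeffBot V (Complex.I * k) ν₂ x₀ -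
      coeffBot V (Complex.I * k) ν₁ x₀ * coeffTop V (Complex.I * k) ν₂ x₀) := by
  refine ⟨exists_isMuPlus hk hV, exists_isMuMinus hk hV, fun u w hu hw x => ?_⟩
  -- The data (1,0) and (0,1) at x₀ give p(ν₁) = -u'(x₀), p(ν₂) = u(x₀), and likewise q with w.
  rw [hu.1.wronskian_eq hw.1 x x₀, ← hu.wronskian_eq hV hk h₁, ← hu.wronskian_eq hV hk h₂,
    ← hw.wronskian_eq hV hk h₁, ← hw.wronskian_eq hV hk h₂, h10, h11, h20, h21]
  ring

end Evans

end ExpDecaySchrodinger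

namespace ExpDecaySchrodinger

open MeasureTheory Set Filter Topology

/-! ### The kernel of the free resolvent -/

theorem integrable_inv_sub_sq_add_sq (r : ℝ) {s : ℝ} (hs : s ≠ 0) :
    Integrable fun ξ : ℝ => ((ξ - r) ^ 2 + s ^ 2)⁻¹ := by
  have h := ((integrable_inv_one_add_sq.comp_div hs).comp_sub_right r).const_mul (s ^ 2)⁻¹
  refine h.congr (Eventually.of_forall fun ξ => ?_)
  simp only
  rw [← mul_inv]
  congr 1
  field_simp
  ring

theorem continuous_inv_sq_sub_sq {k : ℂ} (hk : k.im ≠ 0) :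
    Continuous fun ξ : ℝ => 1 / (k ^ 2 - (ξ : ℂ) ^ 2) := by
  refine Continuous.div continuous_const (by fun_prop) fun ξ h => ?_
  rcases sq_eq_sq_iff_eq_or_eq_neg.1 (sub_eq_zero.1 h) with h | h <;> simp [h] at hk

/-- Factor as (k - ξ)(k + ξ) and use st ≤ s² + t²: both squares are translated Lorentzians of width
|Im k|. -/
theorem integrable_inv_sq_sub_sq {k : ℂ} (hk : k.im ≠ 0) :
    Integrable fun ξ : ℝ => 1 / (k ^ 2 - (ξ : ℂ) ^ 2) := by
  refine ((integrable_inv_sub_sq_add_sq k.re hk).add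
    (integrable_inv_sub_sq_add_sq (-k.re) hk)).mono'
    (continuous_inv_sq_sub_sq hk).aestronglyMeasurable (Eventually.of_forall fun ξ => ?_)
  have e : k ^ 2 - (ξ : ℂ) ^ 2 = (k - ξ) * (k + ξ) := by ring
  have h1 : (ξ - k.re) ^ 2 + k.im ^ 2 = ‖k - ξ‖ ^ 2 := by
    rw [← Complex.normSq_eq_norm_sq, Complex.normSq_apply]
    simp; ring
  have h2 : (ξ - -k.re) ^ 2 + k.im ^ 2 = ‖k + ξ‖ ^ 2 := by
    rw [← Complex.normSq_eq_norm_sq, Complex.normSq_apply]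
    simp; ring
  simp only [Pi.add_apply]
  rw [h1, h2, e, norm_div, norm_one, norm_mul, one_div, mul_inv, ← inv_pow, ← inv_pow]
  have p1 : 0 ≤ ‖k - ξ‖⁻¹ := by positivity
  have p2 : 0 ≤ ‖k + ξ‖⁻¹ := by positivity
  nlinarith [sq_nonneg (‖k - ξ‖⁻¹ - ‖k + ξ‖⁻¹)]

theorem integrable_cexp_neg_mul_abs {c : ℂ} (hc : 0 < c.re) :
    Integrable fun t : ℝ => Complex.exp (-c * |t|) := by
  refine (integrable_exp_neg_mul_abs hc).mono'
    (Continuous.aestronglyMeasurable (by fun_prop)) (Eventually.of_forall fun t => ?_)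
  rw [Complex.norm_exp, Complex.re_mul_ofReal, Complex.neg_re]

open FourierTransform in
theorem fourier_cexp_neg_mul_abs {c : ℂ} (hc : 0 < c.re) (ξ : ℝ) :
    𝓕 (fun t : ℝ => Complex.exp (-c * |t|)) ξ =
      2 * c * (1 / (c ^ 2 + ((2 * Real.pi * ξ : ℝ) : ℂ) ^ 2)) := by
  rw [Real.fourier_real_eq_integral_exp_smul]
  set s : ℂ := ((2 * Real.pi * ξ : ℝ) : ℂ) with hs
  have hint : Integrable fun t : ℝ => Complex.exp (((-2 * Real.pi * t * ξ : ℝ) : ℂ) * Complex.I) •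
      Complex.exp (-c * |t|) := by
    refine (integrable_cexp_neg_mul_abs hc).bdd_mul (c := 1)
      (Continuous.aestronglyMeasurable (by fun_prop)) (Eventually.of_forall fun t => ?_)
    rw [Complex.norm_exp_ofReal_mul_I]
  rw [← intervalIntegral.integral_Iic_add_Ioi (b := 0) hint.integrableOn hint.integrableOn]
  have r1 : (c - s * Complex.I).re = c.re := by simp [hs]
  have r2 : (-c - s * Complex.I).re = -c.re := by simp [hs]
  have e1 : ∫ t in Iic (0 : ℝ), Complex.exp (((-2 * Real.pi * t * ξ : ℝ) : ℂ) * Complex.I) •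
      Complex.exp (-c * |t|) = 1 / (c - s * Complex.I) := by
    have := integral_exp_mul_complex_Iic (a := c - s * Complex.I) (r1 ▸ hc) 0
    simp only [Complex.ofReal_zero, mul_zero, Complex.exp_zero] at this
    rw [← this]
    refine setIntegral_congr_fun measurableSet_Iic fun t ht => ?_
    simp only [smul_eq_mul]
    rw [abs_of_nonpos ht, ← Complex.exp_add, hs]
    push_cast
    ring_nf
  have e2 : ∫ t in Ioi (0 : ℝ), Complex.exp (((-2 * Real.pi * t * ξ : ℝ) : ℂ) * Complex.I) •
      Complex.exp (-c * |t|) = -1 / (-c - s * Complex.I) := by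
    have := integral_exp_mul_complex_Ioi (a := -c - s * Complex.I)
      (by rw [r2]; exact neg_lt_zero.2 hc) 0
    simp only [Complex.ofReal_zero, mul_zero, Complex.exp_zero] at this
    rw [← this]
    refine setIntegral_congr_fun measurableSet_Ioi fun t ht => ?_
    simp only [smul_eq_mul]
    rw [abs_of_pos ht, ← Complex.exp_add, hs]
    push_cast
    ring_nf
  have n1 : c - s * Complex.I ≠ 0 := fun h => by
    rw [h] at r1; simp at r1; linarith
  have n2 : -c - s * Complex.I ≠ 0 := fun h => by
    rw [h] at r2; simp at r2; linarith
  have n3 : c ^ 2 + s ^ 2 = -((c - s * Complex.I) * (-c - s * Complex.I)) := by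
    linear_combination (s ^ 2) * Complex.I_sq
  rw [e1, e2, n3]
  field_simp
  ring

open FourierTransform in
-- Instead of residues: e^{-c|t|} has an explicit integrable Fourier transform, and Fourier
-- inversion returns the integral.
theorem integral_inv_sq_sub_sq_mul_cexp {k : ℂ} (hk : k.im < 0) (t : ℝ) :
    ∫ ξ : ℝ, 1 / (k ^ 2 - (ξ : ℂ) ^ 2) * Complex.exp (Complex.I * t * ξ) =
      2 * Real.pi * (-1 / (2 * (Complex.I * k)) * Complex.exp (-(Complex.I * k) * |t|)) := by
  set c : ℂ := Complex.I * k with hc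
  have hcre : 0 < c.re := by simpa [hc] using hk
  have hc0 : c ≠ 0 := by intro h; rw [h] at hcre; simp at hcre
  have hc2 : c ^ 2 = -k ^ 2 := by rw [hc, mul_pow, Complex.I_sq]; ring
  have hF : 𝓕 (fun t : ℝ => Complex.exp (-c * |t|)) =
      fun ξ : ℝ => -(2 * c) * (1 / (k ^ 2 - ((2 * Real.pi * ξ : ℝ) : ℂ) ^ 2)) := by
    ext ξ
    rw [fourier_cexp_neg_mul_abs hcre, hc2,
      show -k ^ 2 + ((2 * Real.pi * ξ : ℝ) : ℂ) ^ 2 = -(k ^ 2 - ((2 * Real.pi * ξ : ℝ) : ℂ) ^ 2) by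
        ring, one_div_neg_eq_neg_one_div]
    ring
  have hint := integrable_inv_sq_sub_sq hk.ne
  have hFint : Integrable (𝓕 (fun t : ℝ => Complex.exp (-c * |t|))) := by
    rw [hF]
    exact (hint.comp_mul_left' (R := 2 * Real.pi) (by positivity)).const_mul _
  have hcont : Continuous fun t : ℝ => Complex.exp (-c * |t|) := by fun_prop
  have hinv := congrFun (hcont.fourierInv_fourier_eq (integrable_cexp_neg_mul_abs hcre) hFint) t
  rw [Real.fourierInv_eq', hF] at hinv
  have e : ∫ ξ : ℝ, Complex.exp ((2 * Real.pi * inner ℝ ξ t : ℝ) * Complex.I) •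
      (-(2 * c) * (1 / (k ^ 2 - ((2 * Real.pi * ξ : ℝ) : ℂ) ^ 2))) =
      -(2 * c) * ((2 * (Real.pi : ℂ))⁻¹ *
        ∫ ξ : ℝ, 1 / (k ^ 2 - (ξ : ℂ) ^ 2) * Complex.exp (Complex.I * t * ξ)) := by
    have h1 := Measure.integral_comp_mul_left
      (fun ξ : ℝ => 1 / (k ^ 2 - (ξ : ℂ) ^ 2) * Complex.exp (Complex.I * t * ξ)) (2 * Real.pi)
    rw [abs_of_pos (by positivity), Complex.real_smul] at h1
    push_cast at h1
    rw [← h1, ← integral_const_mul]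
    refine integral_congr_ae (Eventually.of_forall fun ξ => ?_)
    simp only [smul_eq_mul, RCLike.inner_apply, conj_trivial]
    push_cast
    ring_nf
  rw [e] at hinv
  have hpi : (Real.pi : ℂ) ≠ 0 := Complex.ofReal_ne_zero.2 Real.pi_ne_zero
  rw [← hinv]
  generalize (∫ ξ : ℝ, 1 / (k ^ 2 - (ξ : ℂ) ^ 2) * Complex.exp (Complex.I * t * ξ)) = J
  field_simp

/-- The resolvent kernel `-(2ik)⁻¹ e^{-ik|x-y|}` applied to `ψ`. -/
noncomputable def kernelOp (k : ℂ) (ψ : ℝ → ℂ) (x : ℝ) : ℂ :=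
  -1 / (2 * (Complex.I * k)) * ∫ y : ℝ, Complex.exp (-(Complex.I * k) * |x - y|) * ψ y

/-- Fubini is legitimate because the multiplier and ψ are both integrable; the inner integral is the
explicit kernel. -/
theorem freeResolvent_eq_kernelOp {k : ℂ} (hk : k.im < 0) {ψ : ℝ → ℂ} (hψ : Integrable ψ)
    (x : ℝ) : freeResolvent (k ^ 2) ψ x = kernelOp k ψ x := by
  have hg := integrable_inv_sq_sub_sq hk.ne
  have hpi : (Real.pi : ℂ) ≠ 0 := Complex.ofReal_ne_zero.2 Real.pi_ne_zero
  have hsq : (1 / (Real.sqrt (2 * Real.pi) : ℂ)) * (1 / (Real.sqrt (2 * Real.pi) : ℂ)) =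
      1 / (2 * Real.pi) := by
    rw [div_mul_div_comm, ← Complex.ofReal_mul, Real.mul_self_sqrt (by positivity)]
    push_cast; ring
  have hprod : Integrable (Function.uncurry fun ξ y : ℝ => 1 / (k ^ 2 - (ξ : ℂ) ^ 2) *
      Complex.exp (Complex.I * (x - y : ℝ) * ξ) * ψ y) (volume.prod volume) := by
    have h1 := (hg.mul_prod hψ).bdd_mul (c := 1)
      (f := fun p : ℝ × ℝ => Complex.exp (Complex.I * (x - p.2 : ℝ) * p.1))
      (Continuous.aestronglyMeasurable (by fun_prop)) (Eventually.of_forall fun p => by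
        rw [mul_assoc, ← Complex.ofReal_mul, mul_comm, Complex.norm_exp_ofReal_mul_I])
    refine h1.congr (Eventually.of_forall fun p => ?_)
    simp only [Function.uncurry]
    ring
  have hswap := integral_integral_swap hprod
  unfold freeResolvent fourierC kernelOp
  have e1 : ∀ ξ : ℝ, 1 / (k ^ 2 - (ξ : ℂ) ^ 2) * Complex.exp (Complex.I * x * ξ) *
      (1 / (Real.sqrt (2 * Real.pi) : ℂ) * ∫ y : ℝ, ψ y * Complex.exp (-(Complex.I * y * ξ))) =
      1 / (Real.sqrt (2 * Real.pi) : ℂ) * ∫ y : ℝ, 1 / (k ^ 2 - (ξ : ℂ) ^ 2) *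
        Complex.exp (Complex.I * (x - y : ℝ) * ξ) * ψ y := by
    intro ξ
    rw [mul_left_comm, ← integral_const_mul]
    congr 1
    refine integral_congr_ae (Eventually.of_forall fun y => ?_)
    simp only
    have : Complex.exp (Complex.I * (x - y : ℝ) * ξ) =
        Complex.exp (Complex.I * x * ξ) * Complex.exp (-(Complex.I * y * ξ)) := by
      rw [← Complex.exp_add]; push_cast; ring_nf
    rw [this]
    ring
  have e2 : ∀ y : ℝ, ∫ ξ : ℝ, 1 / (k ^ 2 - (ξ : ℂ) ^ 2) *
        Complex.exp (Complex.I * (x - y : ℝ) * ξ) * ψ y =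
      2 * Real.pi * (-1 / (2 * (Complex.I * k))) *
        (Complex.exp (-(Complex.I * k) * |x - y|) * ψ y) := by
    intro y
    rw [integral_mul_const, integral_inv_sq_sub_sq_mul_cexp hk]
    ring
  simp only [e1]
  rw [integral_const_mul, hswap]
  simp only [e2]
  rw [integral_const_mul, ← mul_assoc, hsq]
  field_simp

theorem kernelOp_congr_ae {k : ℂ} {ψ φ : ℝ → ℂ} (h : ψ =ᵐ[volume] φ) :
    kernelOp k ψ = kernelOp k φ := by
  ext x
  unfold kernelOp
  congr 1
  refine integral_congr_ae (h.mono fun y hy => ?_)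
  simp only [hy]

/-! ### The continued resolvent as one integral operator on all sheets -/

section Continued

variable {k : ℂ} {b : ℝ} {ψ : ℝ → ℂ}

theorem tendsto_kernelOp (hk0 : k ≠ 0) (hψ : Integrable ψ) (x : ℝ) :
    Tendsto (fun k' => kernelOp k' ψ x) (𝓝[{k' : ℂ | k'.im < 0}] k) (𝓝 (kernelOp k ψ x)) := by
  unfold kernelOp
  refine Tendsto.mul ?_ ?_
  · have : ContinuousAt (fun k' : ℂ => -1 / (2 * (Complex.I * k'))) k :=
      ContinuousAt.div (by fun_prop) (by fun_prop) (by simpa using hk0)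
    exact this.tendsto.mono_left nhdsWithin_le_nhds
  · refine tendsto_integral_filter_of_dominated_convergence (fun y => ‖ψ y‖)
      (Eventually.of_forall fun k' => AEStronglyMeasurable.mul
        (Continuous.aestronglyMeasurable (by fun_prop)) hψ.aestronglyMeasurable) ?_ hψ.norm
      (Eventually.of_forall fun y => ?_)
    · filter_upwards [self_mem_nhdsWithin] with k' hk'
      refine Eventually.of_forall fun y => ?_
      rw [norm_mul]
      refine mul_le_of_le_one_left (norm_nonneg _) ?_
      rw [Complex.norm_exp, Complex.re_mul_ofReal, Real.exp_le_one_iff]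
      have h1 : k'.im < 0 := hk'
      have : (-(Complex.I * k')).re = k'.im := by simp
      rw [this]
      exact mul_nonpos_of_nonpos_of_nonneg h1.le (abs_nonneg _)
    · have : Continuous fun k' : ℂ => Complex.exp (-(Complex.I * k') * |x - y|) * ψ y := by
        fun_prop
      exact (this.tendsto k).mono_left nhdsWithin_le_nhds

theorem neBot_nhdsWithin_im_neg (hk : k.im ≤ 0) : (𝓝[{k' : ℂ | k'.im < 0}] k).NeBot := by
  refine mem_closure_iff_nhdsWithin_neBot.1 ?_
  rw [Complex.closure_setOfPred_im_lt]
  exact hk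

theorem integrable_mul_cexp (hψm : AEStronglyMeasurable ψ)
    (hψ : Integrable fun x : ℝ => Real.exp (b * |x|) * ‖ψ x‖) {z : ℂ} (hz : |z.im| ≤ b) :
    Integrable fun y : ℝ => ψ y * Complex.exp (-(Complex.I * y * z)) := by
  refine hψ.mono' (hψm.mul (Continuous.aestronglyMeasurable (by fun_prop)))
    (Eventually.of_forall fun y => ?_)
  rw [norm_mul, mul_comm, Complex.norm_exp]
  gcongr
  have : (-(Complex.I * y * z)).re = y * z.im := by simp
  rw [this]
  calc y * z.im ≤ |y * z.im| := le_abs_self _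
    _ = |z.im| * |y| := by rw [abs_mul, mul_comm]
    _ ≤ b * |y| := by gcongr

/-- The three branches of A(λ) share one kernel. On the cut this is dominated convergence. On the
second sheet the resolvent at k² has the kernel belonging to -k, and the added term exchanges k and
-k because e^{ik|s|} + e^{-ik|s|} = e^{iks} + e^{-iks}. -/
theorem contResolvent_eq_kernelOp (hk0 : k ≠ 0) (hψm : AEStronglyMeasurable ψ)
    (hb : 0 ≤ b) (hkb : k.im ≤ b) (hψ : Integrable fun x : ℝ => Real.exp (b * |x|) * ‖ψ x‖)
    (x : ℝ) : contResolvent k ψ x = kernelOp k ψ x := by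
  have hψi := integrable_of_integrable_exp_mul hψm hb hψ
  unfold contResolvent
  split_ifs with h1 h2
  · exact freeResolvent_eq_kernelOp h1 hψi x
  · have := neBot_nhdsWithin_im_neg h2.le
    refine Tendsto.limUnder_eq ((tendsto_kernelOp hk0 hψi x).congr' ?_)
    filter_upwards [self_mem_nhdsWithin] with k' hk'
    exact (freeResolvent_eq_kernelOp hk' hψi x).symm
  · have hpos : 0 < k.im := lt_of_le_of_ne (not_lt.1 h1) (Ne.symm h2)
    have hneg : freeResolvent (k ^ 2) ψ x = kernelOp (-k) ψ x := by
      rw [← neg_sq k]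
      exact freeResolvent_eq_kernelOp (by simpa using hpos) hψi x
    rw [hneg]
    have hpi : (Real.pi : ℂ) ≠ 0 := Complex.ofReal_ne_zero.2 Real.pi_ne_zero
    have hsq : (Real.sqrt (2 * Real.pi) : ℂ) * (Real.sqrt (2 * Real.pi) : ℂ) = 2 * Real.pi := by
      rw [← Complex.ofReal_mul, Real.mul_self_sqrt (by positivity)]
      push_cast; ring
    have hs0 : (Real.sqrt (2 * Real.pi) : ℂ) ≠ 0 :=
      Complex.ofReal_ne_zero.2 (Real.sqrt_pos.2 (by positivity)).ne'
    unfold kernelOp fourierC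
    have i1 := integrable_mul_cexp hψm hψ (z := k) (by rwa [abs_of_pos hpos])
    have i2 := integrable_mul_cexp hψm hψ (z := -k) (by
      rwa [Complex.neg_im, abs_neg, abs_of_pos hpos])
    have key : ∫ y : ℝ, Complex.exp (-(Complex.I * -k) * |x - y|) * ψ y =
        Complex.exp (Complex.I * k * x) * (∫ y : ℝ, ψ y * Complex.exp (-(Complex.I * y * k))) +
        Complex.exp (-(Complex.I * k * x)) *
          (∫ y : ℝ, ψ y * Complex.exp (-(Complex.I * y * -k))) -
        ∫ y : ℝ, Complex.exp (-(Complex.I * k) * |x - y|) * ψ y := by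
      have hE : Integrable fun y : ℝ => Complex.exp (-(Complex.I * -k) * |x - y|) * ψ y := by
        refine hψi.bdd_mul (c := 1) (Continuous.aestronglyMeasurable (by fun_prop))
          (Eventually.of_forall fun y => ?_)
        rw [Complex.norm_exp, Complex.re_mul_ofReal, Real.exp_le_one_iff]
        have : (-(Complex.I * -k)).re = -k.im := by simp
        rw [this]
        exact mul_nonpos_of_nonpos_of_nonneg (by linarith) (abs_nonneg _)
      have hS := ((i1.const_mul (Complex.exp (Complex.I * k * x))).add
        (i2.const_mul (Complex.exp (-(Complex.I * k * x)))))
      rw [← integral_const_mul, ← integral_const_mul, ← integral_add (i1.const_mul _)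
        (i2.const_mul _), eq_sub_iff_add_eq, eq_comm]
      have hpt : ∀ y : ℝ, Complex.exp (Complex.I * k * x) *
            (ψ y * Complex.exp (-(Complex.I * y * k))) +
          Complex.exp (-(Complex.I * k * x)) * (ψ y * Complex.exp (-(Complex.I * y * -k))) =
          Complex.exp (-(Complex.I * -k) * |x - y|) * ψ y +
            Complex.exp (-(Complex.I * k) * |x - y|) * ψ y := by
        intro y
        have a1 : Complex.exp (Complex.I * k * x) * Complex.exp (-(Complex.I * y * k)) =
            Complex.exp (Complex.I * k * (x - y : ℝ)) := by
          rw [← Complex.exp_add]; push_cast; ring_nf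
        have a2 : Complex.exp (-(Complex.I * k * x)) * Complex.exp (-(Complex.I * y * -k)) =
            Complex.exp (-(Complex.I * k) * (x - y : ℝ)) := by
          rw [← Complex.exp_add]; push_cast; ring_nf
        have a3 : Complex.exp (-(Complex.I * -k) * |x - y|) +
            Complex.exp (-(Complex.I * k) * |x - y|) =
            Complex.exp (Complex.I * k * (x - y : ℝ)) +
              Complex.exp (-(Complex.I * k) * (x - y : ℝ)) := by
          rcases abs_choice (x - y) with h | h <;> rw [h] <;> push_cast <;> ring_nf
        linear_combination ψ y * (a1 + a2 - a3)
      simp only [hpt] at hS ⊢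
      -- This kernel grows; its integrability comes from the integrable sum minus the decaying
      -- kernel.
      have hE2 : Integrable fun y : ℝ => Complex.exp (-(Complex.I * k) * |x - y|) * ψ y := by
        refine (hS.sub hE).congr (Eventually.of_forall fun y => ?_)
        simp only [Pi.sub_apply, Pi.add_apply]
        linear_combination hpt y
      exact integral_add hE hE2
    rw [key]
    generalize (∫ y : ℝ, ψ y * Complex.exp (-(Complex.I * y * k))) = A
    generalize (∫ y : ℝ, ψ y * Complex.exp (-(Complex.I * y * -k))) = B
    generalize (∫ y : ℝ, Complex.exp (-(Complex.I * k) * |x - y|) * ψ y) = J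
    generalize Complex.exp (Complex.I * k * x) = X
    generalize Complex.exp (-(Complex.I * k * x)) = Y
    generalize (Real.sqrt (2 * Real.pi) : ℂ) = S at *
    have e : Real.pi * Complex.I / S * k⁻¹ * (X * (1 / S * A) + Y * (1 / S * B)) =
        Complex.I / (2 * k) * (X * A + Y * B) := by
      have : Real.pi * Complex.I / S * k⁻¹ * (X * (1 / S * A) + Y * (1 / S * B)) =
        Real.pi * Complex.I / (S * S) * k⁻¹ * (X * A + Y * B) := by field_simp
      rw [this, hsq]
      field_simp
    rw [e]
    field_simp
    linear_combination (X * A + Y * B) * Complex.I_sq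

theorem kernelOp_eq_add {x : ℝ}
    (h1 : IntegrableOn (fun y : ℝ => Complex.exp (-(Complex.I * k) * y) * ψ y) (Ioi x))
    (h2 : IntegrableOn (fun y : ℝ => Complex.exp (Complex.I * k * y) * ψ y) (Iic x)) :
    kernelOp k ψ x = -1 / (2 * (Complex.I * k)) *
      (Complex.exp (-(Complex.I * k) * x) *
          (∫ y in Iic x, Complex.exp (Complex.I * k * y) * ψ y) +
        Complex.exp (Complex.I * k * x) *
          ∫ y in Ioi x, Complex.exp (-(Complex.I * k) * y) * ψ y) := by
  have e1 : EqOn (fun y : ℝ => Complex.exp (-(Complex.I * k) * |x - y|) * ψ y)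
      (fun y : ℝ => Complex.exp (Complex.I * k * x) *
        (Complex.exp (-(Complex.I * k) * y) * ψ y)) (Ioi x) := by
    intro y hy
    simp only
    rw [abs_of_neg (sub_neg.2 hy), ← mul_assoc, ← Complex.exp_add]
    push_cast; ring_nf
  have e2 : EqOn (fun y : ℝ => Complex.exp (-(Complex.I * k) * |x - y|) * ψ y)
      (fun y : ℝ => Complex.exp (-(Complex.I * k) * x) *
        (Complex.exp (Complex.I * k * y) * ψ y)) (Iic x) := by
    intro y hy
    simp only
    rw [abs_of_nonneg (sub_nonneg.2 hy), ← mul_assoc, ← Complex.exp_add]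
    push_cast; ring_nf
  unfold kernelOp
  rw [← intervalIntegral.integral_Iic_add_Ioi (b := x)
    (IntegrableOn.congr_fun (h2.const_mul _) e2.symm measurableSet_Iic)
    (IntegrableOn.congr_fun (h1.const_mul _) e1.symm measurableSet_Ioi),
    setIntegral_congr_fun measurableSet_Iic e2, setIntegral_congr_fun measurableSet_Ioi e1,
    integral_const_mul, integral_const_mul]

end Continued

end ExpDecaySchrodinger

namespace ExpDecaySchrodinger

open MeasureTheory Set Filter Topology

/-! ### Solutions on the Riemann surface -/

theorem I_mul_sq (k : ℂ) : (Complex.I * k) ^ 2 = -k ^ 2 := by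
  rw [mul_pow, Complex.I_sq]; ring

theorem neg_I_mul_sq (k : ℂ) : -(Complex.I * k) ^ 2 = k ^ 2 := by
  rw [I_mul_sq, neg_neg]

theorem isOpen_surface (a : ℝ) : IsOpen (surface a) :=
  isOpen_ne.inter ((isOpen_lt continuous_const Complex.continuous_im).inter
    (isOpen_lt Complex.continuous_im continuous_const))

section Surface

variable {a : ℝ} {V : ℝ → ℂ} {k : ℂ} {u w : ℝ → ℂ}

theorem abs_im_lt_of_mem_surface (hk : k ∈ surface a) : |k.im| < a := abs_lt.2 hk.2

theorem MemWeightedL2.integrable {f : ℝ → ℂ} (hf : MemWeightedL2 a f) (ha : 0 < a) :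
    Integrable f :=
  integrable_of_integrable_exp_mul hf.aestronglyMeasurable le_rfl (hf.integrable_exp_mul ha)

theorem IsSolution.isTame_I_mul (hu : IsSolution V (k ^ 2) u) (ha : 0 < a)
    (hV : MemWeightedL2 (2 * a) V) (hk0 : k ≠ 0) (hka : k.im < a) :
    IsTame V (Complex.I * k) u := by
  rw [← neg_I_mul_sq] at hu
  refine hu.isTame (mul_ne_zero Complex.I_ne_zero hk0) hV.aestronglyMeasurable
    -- For c = ik one has -2 Re c = 2 Im k, so the weight needed is below 2a exactly when Im k < a;
    -- no lower bound on Im k is needed.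
    (hV.integrable_exp_mul (b := max (2 * k.im) 0) (max_lt (by linarith) (by linarith)))
    (le_max_right _ _) ?_
  simp

theorem IsSolution.memWeightedL2 (hu : IsSolution V (k ^ 2) u)
    (hV : MemWeightedL2 (2 * a) V) (hk : k ∈ surface a) :
    MemWeightedL2 (-a) u ∧ MemWeightedL2 a (fun x => V x * u x) := by
  have ha : 0 < a := (abs_nonneg _).trans_lt (abs_im_lt_of_mem_surface hk)
  obtain ⟨C, hC⟩ := hu.exists_norm_le (hV.integrable (by linarith)) (c := Complex.I * k)
    (I_mul_sq k) (mul_ne_zero Complex.I_ne_zero hk.1)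
  have hre : |(Complex.I * k).re| = |k.im| := by simp
  rw [hre] at hC
  exact ⟨memWeightedL2_neg_of_norm_le hu.continuous.aestronglyMeasurable
    (abs_im_lt_of_mem_surface hk) hC, memWeightedL2_mul_of_norm_le hV
    hu.continuous.aestronglyMeasurable (abs_im_lt_of_mem_surface hk).le hC⟩

theorem MemWeightedL2.contResolvent_eq {ψ : ℝ → ℂ} (hψ : MemWeightedL2 a ψ)
    (hk : k ∈ surface a) : contResolvent k ψ = kernelOp k ψ :=
  funext fun x => contResolvent_eq_kernelOp hk.1 hψ.aestronglyMeasurable (abs_nonneg k.im)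
    (le_abs_self _) (hψ.integrable_exp_mul (abs_im_lt_of_mem_surface hk)) x

theorem IsTame.D_eq_sub_kernelOp (h : IsTame V (Complex.I * k) u) (x : ℝ) :
    D V k u x = u x - kernelOp k (fun t => V t * u t) x := by
  have hc0 := h.ne_zero
  rw [h.D_eq x x, kernelOp_eq_add (h.integrableOn_Ioi x) (h.integrableOn_Iic x)]
  unfold coeffTop coeffBot
  have e : Complex.exp (Complex.I * k * x) * Complex.exp (-(Complex.I * k) * x) = 1 := by
    rw [← Complex.exp_add]; simp
  generalize Complex.I * k = c at *
  generalize Complex.exp (c * x) = X at *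
  generalize Complex.exp (-c * x) = Y at *
  field_simp
  linear_combination 2 * c * u x * e

theorem IsSolution.dIsOperator (hu : IsSolution V (k ^ 2) u)
    (hV : MemWeightedL2 (2 * a) V) (hk : k ∈ surface a) : DIsOperator a V k u := by
  have ha : 0 < a := (abs_nonneg _).trans_lt (abs_im_lt_of_mem_surface hk)
  obtain ⟨h1, h2⟩ := hu.memWeightedL2 hV hk
  refine ⟨h1, h2, fun x => ?_⟩
  rw [h2.contResolvent_eq hk]
  exact (hu.isTame_I_mul ha hV hk.1 hk.2.2).D_eq_sub_kernelOp x

/-! ### Generalized eigenvalues and eigenfunctions -/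

theorem IsPrimitive.congr_ae {F f g : ℝ → ℂ} (h : IsPrimitive F f) (hfg : f =ᵐ[volume] g) :
    IsPrimitive F g := fun x y =>
  ⟨(h.intervalIntegrable x y).congr_ae (ae_restrict_of_ae hfg), by
    rw [← h.integral_eq x y]
    exact intervalIntegral.integral_congr_ae (hfg.mono fun t ht _ => ht.symm)⟩

/-- Splitting the kernel at y = x is variation of constants, so y = A(λ)ψ satisfies y'' + k²y = ψ.
Substituting ψ = Vy gives (1), and an almost-everywhere identity is enough. -/
theorem isSolution_kernelOp {ψ : ℝ → ℂ} (hψ : MemWeightedL2 a ψ) (hk : k ∈ surface a)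
    (h : ψ =ᵐ[volume] fun x => V x * kernelOp k ψ x) :
    IsSolution V (k ^ 2) (kernelOp k ψ) := by
  have hint := hψ.integrable_exp_mul (abs_im_lt_of_mem_surface hk)
  have i1 : Integrable fun y : ℝ => Complex.exp (-(Complex.I * k) * y) * ψ y :=
    (integrable_mul_cexp hψ.aestronglyMeasurable hint (z := k) le_rfl).congr
      (Eventually.of_forall fun y => by simp only; rw [mul_comm]; ring_nf)
  have i2 : Integrable fun y : ℝ => Complex.exp (Complex.I * k * y) * ψ y :=
    (integrable_mul_cexp hψ.aestronglyMeasurable hint (z := -k) (by simp)).congr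
      (Eventually.of_forall fun y => by simp only; rw [mul_comm]; ring_nf)
  have hA := ((isPrimitive_integral_Ioi fun x => i1.integrableOn (s := Ioi x)).const_mul
    (-1)).congr_right (g := fun y : ℝ => Complex.exp (-(Complex.I * k) * y) * ψ y)
      (funext fun x => by ring)
  have hB := isPrimitive_integral_Iic fun x => i2.integrableOn (s := Iic x)
  obtain ⟨h1, h2⟩ := isPrimitive_variation (mul_ne_zero Complex.I_ne_zero hk.1) hA hB
  have e : kernelOp k ψ = fun x : ℝ => 1 / (2 * (Complex.I * k)) *
      (Complex.exp (Complex.I * k * x) *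
          (-1 * ∫ y in Ioi x, Complex.exp (-(Complex.I * k) * y) * ψ y) -
        Complex.exp (-(Complex.I * k) * x) *
          ∫ y in Iic x, Complex.exp (Complex.I * k * y) * ψ y) := by
    ext x
    rw [kernelOp_eq_add i1.integrableOn i2.integrableOn]
    ring
  rw [← e] at h1
  refine (isSolution_of_isPrimitive h1 (h2.congr_ae ?_)).1
  filter_upwards [h] with x hx
  rw [← congrFun e x]
  nth_rewrite 1 [hx]
  rw [I_mul_sq]
  ring

/-- Nonzero solutions annihilated by `D`. -/
def HasNullSolution (V : ℝ → ℂ) (k : ℂ) : Prop :=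
  ∃ u, IsSolution V (k ^ 2) u ∧ u ≠ 0 ∧ ∀ x, D V k u x = 0

theorem hasNullSolution_of_ae_eq {ψ : ℝ → ℂ} (hV : MemWeightedL2 (2 * a) V) (hk : k ∈ surface a)
    (hψ : MemWeightedL2 a ψ) (hψ0 : ¬ ψ =ᵐ[volume] 0)
    (h : ψ =ᵐ[volume] fun x => V x * kernelOp k ψ x) : HasNullSolution V k := by
  have ha : 0 < a := (abs_nonneg _).trans_lt (abs_im_lt_of_mem_surface hk)
  have hs := isSolution_kernelOp hψ hk h
  refine ⟨kernelOp k ψ, hs, fun h0 => hψ0 ?_, fun x => ?_⟩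
  · filter_upwards [h] with x hx
    rw [hx, h0]; simp
  · rw [(hs.isTame_I_mul ha hV hk.1 hk.2.2).D_eq_sub_kernelOp, ← kernelOp_congr_ae h, sub_self]

/-- Null vectors of id - K^×A(λ) and of id - A(λ)K^× correspond through u = A(λ)ψ and ψ = Vu, and
neither map kills a nonzero null vector. -/
theorem isGenEigenvalue_iff (hV : MemWeightedL2 (2 * a) V) (hk : k ∈ surface a) :
    IsGenEigenvalue a V k ↔ HasNullSolution V k := by
  have ha : 0 < a := (abs_nonneg _).trans_lt (abs_im_lt_of_mem_surface hk)
  constructor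
  · rintro ⟨ψ, hψ, hψ0, h⟩
    rw [hψ.contResolvent_eq hk] at h
    exact hasNullSolution_of_ae_eq hV hk hψ hψ0 h
  · rintro ⟨u, hu, hu0, hD⟩
    have hX := (hu.memWeightedL2 hV hk).2
    have huk : u = kernelOp k (fun t => V t * u t) := funext fun x => by
      have := (hu.isTame_I_mul ha hV hk.1 hk.2.2).D_eq_sub_kernelOp x
      rw [hD x] at this
      exact (sub_eq_zero.1 this.symm)
    refine ⟨fun t => V t * u t, hX, fun h0 => hu0 ?_, ?_⟩
    · rw [huk, kernelOp_congr_ae h0]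
      ext x
      simp [kernelOp]
    · rw [hX.contResolvent_eq hk, ← huk]

theorem exists_isGenEigenfunction_iff (hV : MemWeightedL2 (2 * a) V) (hk : k ∈ surface a) :
    (∃ μ, IsGenEigenfunction a V k μ) ↔ HasNullSolution V k := by
  have ha : 0 < a := (abs_nonneg _).trans_lt (abs_im_lt_of_mem_surface hk)
  constructor
  · rintro ⟨μ, -, hμ0, hX, h⟩
    rw [hX.contResolvent_eq hk] at h
    -- Passing to ψ = Vμ replaces μ, known only almost everywhere, by the differentiable
    -- representative A(λ)ψ.
    refine hasNullSolution_of_ae_eq hV hk hX (fun h0 => hμ0 ?_) ?_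
    · rw [kernelOp_congr_ae h0] at h
      filter_upwards [h] with x hx
      rw [hx]; simp [kernelOp]
    · filter_upwards [h] with x hx
      rw [← hx]
  · rintro ⟨u, hu, hu0, hD⟩
    obtain ⟨h1, hX⟩ := hu.memWeightedL2 hV hk
    refine ⟨u, h1, fun h0 => hu0 ?_, hX, Eventually.of_forall fun x => ?_⟩
    · exact (hu.continuous.ae_eq_iff_eq volume continuous_const).1 h0
    · have := (hu.isTame_I_mul ha hV hk.1 hk.2.2).D_eq_sub_kernelOp x
      rw [hD x] at this
      rw [hX.contResolvent_eq hk]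
      exact sub_eq_zero.1 this.symm

/-! ### Zeros of the determinant -/

/-- e^{cx} and e^{-cx} are independent for c ≠ 0; the values of D and D' at x₀ already separate the
two coefficients. -/
theorem IsTame.D_eq_zero_iff (h : IsTame V (Complex.I * k) u) (x₀ : ℝ) :
    (∀ x, D V k u x = 0) ↔
      coeffTop V (Complex.I * k) u x₀ = 0 ∧ coeffBot V (Complex.I * k) u x₀ = 0 := by
  constructor
  · intro h0
    have hD : D V k u = fun _ => 0 := funext h0
    have h1 := h0 x₀
    have h2 := (h.hasDerivAt_D x₀ x₀).unique (hD ▸ hasDerivAt_const x₀ (0 : ℂ))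
    rw [h.D_eq x₀, mul_eq_zero, or_iff_right
      (one_div_ne_zero (mul_ne_zero two_ne_zero h.ne_zero))] at h1
    have e1 := Complex.exp_ne_zero (Complex.I * k * x₀)
    have e2 := Complex.exp_ne_zero (-(Complex.I * k) * x₀)
    constructor
    · refine (mul_eq_zero.1 (?_ : Complex.exp (Complex.I * k * x₀) * _ = 0)).resolve_left e1
      linear_combination h2 + 1 / 2 * h1
    · refine (mul_eq_zero.1 (?_ : Complex.exp (-(Complex.I * k) * x₀) * _ = 0)).resolve_left e2
      linear_combination h2 - 1 / 2 * h1
  · rintro ⟨h1, h2⟩ x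
    rw [h.D_eq x₀, h1, h2]; simp

theorem IsTame.coeff_linear_combination {c : ℂ} (hu : IsTame V c u) (hw : IsTame V c w)
    (α β : ℂ) (x₀ : ℝ) :
    coeffTop V c (fun x => α * u x + β * w x) x₀ =
        α * coeffTop V c u x₀ + β * coeffTop V c w x₀ ∧
      coeffBot V c (fun x => α * u x + β * w x) x₀ =
        α * coeffBot V c u x₀ + β * coeffBot V c w x₀ := by
  have hd := (hu.isSolution.linear_combination hw.isSolution α β).2
  unfold coeffTop coeffBot
  rw [hd]
  constructor
  · have e : ∫ y in Ioi x₀, Complex.exp (-c * y) * (V y * (α * u y + β * w y)) =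
        α * (∫ y in Ioi x₀, Complex.exp (-c * y) * (V y * u y)) +
          β * ∫ y in Ioi x₀, Complex.exp (-c * y) * (V y * w y) := by
      rw [← integral_const_mul, ← integral_const_mul, ← integral_add
        ((hu.integrableOn_Ioi x₀).const_mul α) ((hw.integrableOn_Ioi x₀).const_mul β)]
      refine integral_congr_ae (Eventually.of_forall fun y => ?_)
      simp only
      ring
    rw [e]; ring
  · have e : ∫ y in Iic x₀, Complex.exp (c * y) * (V y * (α * u y + β * w y)) =
        α * (∫ y in Iic x₀, Complex.exp (c * y) * (V y * u y)) +
          β * ∫ y in Iic x₀, Complex.exp (c * y) * (V y * w y) := by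
      rw [← integral_const_mul, ← integral_const_mul, ← integral_add
        ((hu.integrableOn_Iic x₀).const_mul α) ((hw.integrableOn_Iic x₀).const_mul β)]
      refine integral_congr_ae (Eventually.of_forall fun y => ?_)
      simp only
      ring
    rw [e]; ring

theorem exists_ne_zero_of_det_eq_zero {p q r s : ℂ} (h : p * s - r * q = 0) :
    ∃ α β : ℂ, ¬ (α = 0 ∧ β = 0) ∧ α * p + β * q = 0 ∧ α * r + β * s = 0 := by
  by_cases h1 : q = 0 ∧ p = 0
  · by_cases h2 : s = 0 ∧ r = 0
    · exact ⟨1, 0, by simp, by simp [h1], by simp [h2]⟩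
    · refine ⟨s, -r, by simpa using h2, by rw [h1.1, h1.2]; ring, by ring⟩
  · exact ⟨q, -p, by simpa using h1, by ring, by linear_combination -h⟩

/-- Linear algebra in the two-dimensional solution space: the determinant is, up to 1/(2c), that of
u ↦ (p(u), q(u)) in the basis ν₁, ν₂, and the kernel of this map consists of the solutions with D =
0. -/
theorem detD_eq_zero_iff (ha : 0 < a) (hV : MemWeightedL2 (2 * a) V) (hk0 : k ≠ 0)
    (hka : k.im < a) {ν₁ ν₂ : ℝ → ℂ} {x₀ : ℝ} (h₁ : IsSolution V (k ^ 2) ν₁)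
    (h₂ : IsSolution V (k ^ 2) ν₂) (h10 : ν₁ x₀ = 1) (h11 : deriv ν₁ x₀ = 0) (h20 : ν₂ x₀ = 0)
    (h21 : deriv ν₂ x₀ = 1) (x : ℝ) : detD V k ν₁ ν₂ x = 0 ↔ HasNullSolution V k := by
  have t₁ := h₁.isTame_I_mul ha hV hk0 hka
  have t₂ := h₂.isTame_I_mul ha hV hk0 hka
  have hVi : ∀ x y, IntervalIntegrable V volume x y := fun x y =>
    (hV.integrable (by linarith)).intervalIntegrable
  rw [t₁.detD_eq t₂ x₀, mul_eq_zero, or_iff_right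
      (one_div_ne_zero (mul_ne_zero two_ne_zero t₁.ne_zero))]
  have hcomb : ∀ α β : ℂ, (∀ x, D V k (fun x => α * ν₁ x + β * ν₂ x) x = 0) ↔
      α * coeffTop V (Complex.I * k) ν₁ x₀ + β * coeffTop V (Complex.I * k) ν₂ x₀ = 0 ∧
      α * coeffBot V (Complex.I * k) ν₁ x₀ + β * coeffBot V (Complex.I * k) ν₂ x₀ = 0 := by
    intro α β
    obtain ⟨e1, e2⟩ := t₁.coeff_linear_combination t₂ α β x₀
    rw [← e1, ← e2]
    exact ((h₁.linear_combination h₂ α β).1.isTame_I_mul ha hV hk0 hka).D_eq_zero_iff x₀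
  constructor
  · intro h
    obtain ⟨α, β, hne, hp, hm⟩ := exists_ne_zero_of_det_eq_zero h
    obtain ⟨hs, hd⟩ := h₁.linear_combination h₂ α β
    refine ⟨_, hs, fun h0 => hne ⟨?_, ?_⟩, (hcomb α β).2 ⟨hp, hm⟩⟩
    · have := congrFun h0 x₀
      simpa [h10, h20] using this
    · have h3 := congrFun hd x₀
      rw [h0] at h3
      have h4 : deriv (0 : ℝ → ℂ) x₀ = 0 := deriv_const x₀ 0
      rw [h4] at h3
      simpa [h11, h21] using h3.symm
  · rintro ⟨u, hu, hu0, hD⟩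
    obtain ⟨hs, hd⟩ := h₁.linear_combination h₂ (u x₀) (deriv u x₀)
    have huν : u = fun x => u x₀ * ν₁ x + deriv u x₀ * ν₂ x := by
      refine hu.ext hs hVi (x₀ := x₀) ?_ ?_
      · simp [h10, h20]
      · rw [hd]; simp [h11, h21]
    rw [huν] at hD
    obtain ⟨hp, hm⟩ := (hcomb _ _).1 hD
    have hne : ¬ (u x₀ = 0 ∧ deriv u x₀ = 0) := fun h => hu0 (by
      rw [huν, h.1, h.2]; ext; simp)
    rw [not_and_or] at hne
    rcases hne with hne | hne
    · refine (mul_eq_zero.1 (?_ : u x₀ * _ = 0)).resolve_left hne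
      linear_combination coeffBot V (Complex.I * k) ν₂ x₀ * hp -
        coeffTop V (Complex.I * k) ν₂ x₀ * hm
    · refine (mul_eq_zero.1 (?_ : deriv u x₀ * _ = 0)).resolve_left hne
      linear_combination coeffTop V (Complex.I * k) ν₁ x₀ * hm -
        coeffBot V (Complex.I * k) ν₁ x₀ * hp

/-! ### Holomorphy of the determinant -/

/-- The exponential and the solution each grow at most like e^{κ|t|} with κ < a near k₀, so
e^{2κ|t|}‖V‖ dominates. The sign ε = ±1 covers both coefficients. -/
theorem differentiableOn_integral_exp_mul (hV : MemWeightedL2 (2 * a) V) {x₀ : ℝ}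
    {c₀ c₁ : ℂ} {y : ℂ → ℝ → ℂ}
    (hy : ∀ lam, IsSolution V lam (y lam) ∧ y lam x₀ = c₀ ∧ deriv (y lam) x₀ = c₁)
    (hyd : ∀ x, Differentiable ℂ (fun lam => y lam x)) {ε : ℝ} (hε : |ε| = 1) (S : Set ℝ) :
    DifferentiableOn ℂ (fun k : ℂ => ∫ t in S,
      Complex.exp (ε * (Complex.I * k) * t) * (V t * y (k ^ 2) t)) (surface a) := by
  refine differentiableOn_integral_of_dominated (isOpen_surface a) (fun k _ => ?_) (fun t => ?_)
    fun k₀ hk₀ => ?_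
  · exact (AEStronglyMeasurable.mul (Continuous.aestronglyMeasurable (by fun_prop))
      (hV.aestronglyMeasurable.mul (hy (k ^ 2)).1.continuous.aestronglyMeasurable)).restrict
  · have : Differentiable ℂ fun k : ℂ => y (k ^ 2) t :=
      (hyd t).comp (differentiable_id.pow 2)
    exact Differentiable.differentiableOn (by fun_prop)
  · have hlt := abs_im_lt_of_mem_surface hk₀
    have ha : 0 < a := (abs_nonneg _).trans_lt hlt
    have hVi := hV.integrable (by linarith)
    have hm : 0 < ‖k₀‖ / 2 := by have := norm_pos_iff.2 hk₀.1; positivity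
    -- Within r of k₀, ‖k‖ ≥ m keeps the divisions by ‖c‖ in the growth bound under control, and |Im
    -- k| ≤ κ, the midpoint of |Im k₀| and a. The factor e^{κ|x₀|} in C shifts the base point from
    -- x₀ to 0.
    set m := ‖k₀‖ / 2 with hm_def
    set r := min m ((a - |k₀.im|) / 2) with hr
    set κ := (a + |k₀.im|) / 2 with hκ
    set C := (‖c₀‖ + ‖c₁‖ / m) * Real.exp ((∫ t, ‖V t‖) / m) * Real.exp (κ * |x₀|) with hC
    refine ⟨r, lt_min hm (by linarith), fun t => C * (Real.exp (2 * κ * |t|) * ‖V t‖),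
      ((hV.integrable_exp_mul (by linarith)).const_mul C).integrableOn,
      Eventually.of_forall fun t k hk => ?_⟩
    have hd : ‖k - k₀‖ < r := mem_ball_iff_norm.1 hk.1
    have hkm : m ≤ ‖k‖ := by
      have h1 := norm_le_insert k k₀
      have h2 := hd.trans_le (min_le_left _ _)
      rw [hm_def] at h2 ⊢
      linarith
    have hkκ : |k.im| ≤ κ := by
      have h1 : |(k - k₀).im| ≤ ‖k - k₀‖ := Complex.abs_im_le_norm _
      have h2 := hd.trans_le (min_le_right _ _)
      have h3 : |k.im| ≤ |k₀.im| + |(k - k₀).im| := by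
        rw [Complex.sub_im]
        simpa using abs_add_le k₀.im (k.im - k₀.im)
      rw [hκ]
      linarith
    have hκ0 : 0 ≤ κ := (abs_nonneg _).trans hkκ
    have hsol := (hy (k ^ 2)).1.norm_le hVi (c := Complex.I * k)
      (I_mul_sq k) (mul_ne_zero Complex.I_ne_zero hk.2.1) x₀ t
    rw [(hy (k ^ 2)).2.1, (hy (k ^ 2)).2.2] at hsol
    have hre : |(Complex.I * k).re| = |k.im| := by simp
    have hno : ‖Complex.I * k‖ = ‖k‖ := by simp
    rw [hre, hno] at hsol
    have hV0 : 0 ≤ ∫ t, ‖V t‖ := integral_nonneg fun _ => norm_nonneg _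
    have hsol' : ‖y (k ^ 2) t‖ ≤ C * Real.exp (κ * |t|) := by
      refine hsol.trans ?_
      rw [hC, mul_assoc _ (Real.exp (κ * |x₀|)), ← Real.exp_add]
      gcongr
      calc |k.im| * |t - x₀| ≤ κ * (|t| + |x₀|) := by
            gcongr
            exact abs_sub _ _
        _ = _ := by ring
    have hexp : ‖Complex.exp (ε * (Complex.I * k) * t)‖ ≤ Real.exp (κ * |t|) := by
      rw [Complex.norm_exp, Real.exp_le_exp]
      have e : (ε * (Complex.I * k) * t).re = -(ε * k.im * t) := by simp
      rw [e]
      calc -(ε * k.im * t) ≤ |ε * k.im * t| := neg_le_abs _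
        _ = |k.im| * |t| := by rw [abs_mul, abs_mul, hε, one_mul]
        _ ≤ κ * |t| := by gcongr
    rw [norm_mul, norm_mul]
    calc _ ≤ Real.exp (κ * |t|) * (‖V t‖ * (C * Real.exp (κ * |t|))) := by gcongr
      _ = C * (Real.exp (κ * |t|) * Real.exp (κ * |t|) * ‖V t‖) := by ring
      _ = _ := by rw [← Real.exp_add]; ring_nf

theorem differentiableOn_coeff (hV : MemWeightedL2 (2 * a) V) {x₀ : ℝ} {c₀ c₁ : ℂ}
    {y : ℂ → ℝ → ℂ}
    (hy : ∀ lam, IsSolution V lam (y lam) ∧ y lam x₀ = c₀ ∧ deriv (y lam) x₀ = c₁)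
    (hyd : ∀ x, Differentiable ℂ (fun lam => y lam x)) :
    DifferentiableOn ℂ (fun k => coeffTop V (Complex.I * k) (y (k ^ 2)) x₀) (surface a) ∧
      DifferentiableOn ℂ (fun k => coeffBot V (Complex.I * k) (y (k ^ 2)) x₀) (surface a) := by
  have h1 := differentiableOn_integral_exp_mul hV hy hyd (ε := -1) (by simp) (Ioi x₀)
  have h2 := differentiableOn_integral_exp_mul hV hy hyd (ε := 1) (by simp) (Iic x₀)
  simp only [Complex.ofReal_neg, Complex.ofReal_one, neg_mul, one_mul] at h1 h2
  unfold coeffTop coeffBot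
  simp only [fun lam => (hy lam).2.1, fun lam => (hy lam).2.2, neg_mul]
  exact ⟨DifferentiableOn.add (Differentiable.differentiableOn (by fun_prop)) h1,
    DifferentiableOn.sub (Differentiable.differentiableOn (by fun_prop)) h2⟩

end Surface

end ExpDecaySchrodinger

/-! ### Assembly of the theorem -/

open ExpDecaySchrodinger in
theorem theorem4p1 (a : ℝ) (ha : 0 < a) (V : ℝ → ℂ)
    (hV : MeasureTheory.MemLp (fun x : ℝ => (Real.exp (2 * a * |x|) : ℂ) * V x) 2
      MeasureTheory.volume)
    (x₀ : ℝ) :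
    ∃ (ν₁ ν₂ : ℂ → ℝ → ℂ) (DD E : ℂ → ℂ),
      -- `ν₁(·, λ)` and `ν₂(·, λ)` are the solutions with data `(1, 0)` and `(0, 1)` at `x₀`
      (∀ (lam : ℂ) (u : ℝ → ℂ),
        (IsSolution V lam u ∧ u x₀ = 1 ∧ deriv u x₀ = 0) ↔ u = ν₁ lam) ∧
      (∀ (lam : ℂ) (u : ℝ → ℂ),
        (IsSolution V lam u ∧ u x₀ = 0 ∧ deriv u x₀ = 1) ↔ u = ν₂ lam) ∧
      -- the determinant is well defined on the first sheet and on `P(a)`, with a value `DD k`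
      -- that does not depend on `x`
      (∀ k : ℂ, k ≠ 0 → k.im < a →
        DWellDefined V k (ν₁ (k ^ 2)) ∧ DWellDefined V k (ν₂ (k ^ 2)) ∧
          ∀ x : ℝ, detD V k (ν₁ (k ^ 2)) (ν₂ (k ^ 2)) x = DD k) ∧
      (∀ k ∈ surface a, DIsOperator a V k (ν₁ (k ^ 2)) ∧ DIsOperator a V k (ν₂ (k ^ 2))) ∧
      -- `E` is the Evans function
      (∀ k : ℂ, k.im < 0 → IsEvansValue V k (E k)) ∧
      -- (i)
      DifferentiableOn ℂ DD (surface a) ∧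
      -- (ii)
      (∀ k ∈ surface a, (DD k = 0 ↔ IsGenEigenvalue a V k) ∧
        (DD k = 0 ↔ ∃ μ : ℝ → ℂ, IsGenEigenfunction a V k μ)) ∧
      -- (iii)
      (∀ k : ℂ, k.im < 0 → DD k = 1 / (2 * (Complex.I * k)) * E k) := by
  have hVw : MemWeightedL2 (2 * a) V := hV
  have hVint : MeasureTheory.Integrable V := hVw.integrable (by linarith)
  have hVi : ∀ x y, IntervalIntegrable V MeasureTheory.volume x y := fun x y =>
    hVint.intervalIntegrable
  obtain ⟨ν₁, h₁, hd₁⟩ := exists_isSolution hVi x₀ 1 0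
  obtain ⟨ν₂, h₂, hd₂⟩ := exists_isSolution hVi x₀ 0 1
  have tame : ∀ k : ℂ, k ≠ 0 → k.im < a →
      IsTame V (Complex.I * k) (ν₁ (k ^ 2)) ∧ IsTame V (Complex.I * k) (ν₂ (k ^ 2)) :=
    fun k hk0 hka => ⟨(h₁ (k ^ 2)).1.isTame_I_mul ha hVw hk0 hka,
      (h₂ (k ^ 2)).1.isTame_I_mul ha hVw hk0 hka⟩
  have hne : ∀ k : ℂ, k.im < 0 → k ≠ 0 := fun k hk h0 => by simp [h0] at hk
  -- E is taken to be the determinant of the coefficients p and q, so (iii) is the formula for the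
  -- determinant, and the Jost solutions enter only in showing that E is the Evans function.
  refine ⟨ν₁, ν₂, fun k => detD V k (ν₁ (k ^ 2)) (ν₂ (k ^ 2)) x₀, fun k =>
    coeffTop V (Complex.I * k) (ν₁ (k ^ 2)) x₀ * coeffBot V (Complex.I * k) (ν₂ (k ^ 2)) x₀ -
      coeffBot V (Complex.I * k) (ν₁ (k ^ 2)) x₀ * coeffTop V (Complex.I * k) (ν₂ (k ^ 2)) x₀,
    fun lam u => ⟨fun h => ?_, fun h => h ▸ h₁ lam⟩,
    fun lam u => ⟨fun h => ?_, fun h => h ▸ h₂ lam⟩,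
    fun k hk0 hka => ?_, fun k hk => ⟨(h₁ _).1.dIsOperator hVw hk, (h₂ _).1.dIsOperator hVw hk⟩,
    fun k hk => ?_, ?_, fun k hk => ?_, fun k hk => ?_⟩
  · exact h.1.ext (h₁ lam).1 hVi (h.2.1.trans (h₁ lam).2.1.symm) (h.2.2.trans (h₁ lam).2.2.symm)
  · exact h.1.ext (h₂ lam).1 hVi (h.2.1.trans (h₂ lam).2.1.symm) (h.2.2.trans (h₂ lam).2.2.symm)
  · obtain ⟨t₁, t₂⟩ := tame k hk0 hka
    refine ⟨t₁.dWellDefined, t₂.dWellDefined, fun x => ?_⟩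
    exact (t₁.detD_eq t₂ x₀ x).trans (t₁.detD_eq t₂ x₀ x₀).symm
  · obtain ⟨t₁, t₂⟩ := tame k (hne k hk) (hk.trans ha)
    exact isEvansValue hVint hk t₁ t₂ (h₁ _).2.1 (h₁ _).2.2 (h₂ _).2.1 (h₂ _).2.2
  · obtain ⟨p₁, m₁⟩ := differentiableOn_coeff (a := a) hVw h₁ hd₁
    obtain ⟨p₂, m₂⟩ := differentiableOn_coeff (a := a) hVw h₂ hd₂
    have hinv : DifferentiableOn ℂ (fun k : ℂ => 1 / (2 * (Complex.I * k))) (surface a) :=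
      DifferentiableOn.div (by fun_prop) (by fun_prop) fun k hk =>
        mul_ne_zero two_ne_zero (mul_ne_zero Complex.I_ne_zero hk.1)
    refine (hinv.mul ((p₁.mul m₂).sub (m₁.mul p₂))).congr fun k hk => ?_
    obtain ⟨t₁, t₂⟩ := tame k hk.1 hk.2.2
    exact t₁.detD_eq t₂ x₀ x₀
  · have h0 := detD_eq_zero_iff ha hVw hk.1 hk.2.2 (h₁ _).1 (h₂ _).1 (h₁ _).2.1 (h₁ _).2.2
      (h₂ _).2.1 (h₂ _).2.2 x₀
    exact ⟨h0.trans (isGenEigenvalue_iff hVw hk).symm,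
      h0.trans (exists_isGenEigenfunction_iff hVw hk).symm⟩
  · obtain ⟨t₁, t₂⟩ := tame k (hne k hk) (hk.trans ha)
    exact t₁.detD_eq t₂ x₀ x₀
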